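/- Let $M$ be an oriented smooth surface, $r\ge 6$, and $\alpha:M\to\mathbb R^3$ an immersion of class $C^r$, with unit normal $N=\alpha_u\wedge\alpha_v/|\alpha_u\wedge\alpha_v|$ in positive charts $(u,v)$, first and second fundamental forms $I_\alpha$, $II_\alpha$, Gaussian curvature $\mathcal K_\alpha$, normal curvature $k_n=II_\alpha/I_\alpha$, and geodesic torsion $\tau_g$, defined along a curve with unit tangent $T$ by $N'=-k_nT-\tau_g\,N\wedge T$. A *maximal geometric mean curvature line* of $\alpha$ is a regular curve in the region $\mathcal K_\alpha>0$ with $k_n=\sqrt{\mathcal K_\alpha}$ and $\tau_g>0$; a *maximal geometric mean curvature cycle* is a simple closed such line. Let $c$ be a maximal geometric mean curvature cycle of $\alpha$, parametrized by $\alpha$-arc length $s$ and of length $L$, and let $(s,v)$, with $s\in\mathbb R/L\mathbb Z$, $|v|<\eta$, be a chart of class $C^{r-2}$ around $c=\{v=0\}$ in which $$\alpha(s,v)=c(s)+v\,(N\wedge T)(s)+W(s,v)\,N(s)$$ for some real function $W$ (where $c(s)$ also denotes the point $\alpha(c(s))$, and $N(s)$, $T(s)$ are the normal and the unit tangent of $\alpha$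 at $c(s)$). Let $\delta:\mathbb R\to\mathbb R$ be a $C^\infty$ function with $\delta=1$ in a neighborhood of $0$ and with support contained in $(-\eta,\eta)$, let $\tau_g(s)>0$ be the geodesic torsion of $c$ for $\alpha$, and for $\epsilon\in\mathbb R$ put $$\beta_\epsilon(s,v)=\alpha(s,v)+\epsilon\,\frac{\tau_g(s)}{6}\,v^3\,\delta(v)\,N(s)$$ in the chart, and $\beta_\epsilon=\alpha$ outside the domain of the chart. The return map $\pi_\epsilon$ of $\beta_\epsilon$ along $c$ is defined near $0$ by $\pi_\epsilon(v_0)=v(L)$, where $s\mapsto(s,v(s))$, $0\le s\le L$, is the maximal geometric mean curvature line of $\beta_\epsilon$ with $v(0)=v_0$; the cycle $c$ is *hyperbolic* for $\beta_\epsilon$ if $\pi_\epsilon'(0)\ne1$. Then there is $\epsilon_0>0$ such that, for all $|\epsilon|<\epsilon_0$, $\beta_\epsilon$ is an immersion of class $C^{r-2}$, $c$ is a maximal geometric mean curvature cycle of $\beta_\epsilon$ of length $L$, the return map $\pi_\epsilon$ is defined near $0$ and differentiable at $0$ with $\pi_\epsilon'(0)>0$, and $c$ is hyperbolic for $\beta_\epsilon$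 if moreover $\epsilon\neq0$. Furthermore $$\frac{d}{d\epsilon}\ln\pi_\epsilon'(0)\Big|_{\epsilon=0}=\frac L4 .$$ -/

import Mathlib

open Set Filter Topology
open scoped Manifold ContDiff

/-- The model plane `ℝ²`. -/
abbrev E2 : Type := EuclideanSpace ℝ (Fin 2)

/-- Euclidean three-space `ℝ³`, with its standard orientation. -/
abbrev E3 : Type := EuclideanSpace ℝ (Fin 3)

namespace GMC

/-- The vector product of `ℝ³`. -/
noncomputable def cross (x y : E3) : E3 :=
  WithLp.toLp 2 (crossProduct (WithLp.ofLp x) (WithLp.ofLp y))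

/-- The first coordinate vector of `ℝ²`. -/
noncomputable def e1 : E2 := EuclideanSpace.single 0 1

/-- The second coordinate vector of `ℝ²`. -/
noncomputable def e2 : E2 := EuclideanSpace.single 1 1

section Surface

/-- The surface `M` is oriented by its atlas: all changes of charts have positive Jacobian
determinant, so that every chart of the atlas is a positive chart. -/
def IsOrientedAtlas (M : Type*) [TopologicalSpace M] [ChartedSpace E2 M] : Prop :=
  ∀ e ∈ atlas E2 M, ∀ e' ∈ atlas E2 M, ∀ x ∈ (e.symm.trans e').source,
    0 < (fderiv ℝ (e.symm.trans e') x).det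

variable {M : Type*} [TopologicalSpace M] [ChartedSpace E2 M]

/-- `α` is an immersion of class `C^n` of `M` in `ℝ³`. -/
structure IsImmersionOfClass (n : WithTop ℕ∞) (α : M → E3) : Prop where
  contMDiff : ContMDiff 𝓘(ℝ, E2) 𝓘(ℝ, E3) n α
  injective : ∀ p, Function.Injective (mfderiv 𝓘(ℝ, E2) 𝓘(ℝ, E3) α p)

/-- The differential of `α` at `p`, read in the preferred chart at `p`. -/
noncomputable def diffAt (α : M → E3) (p : M) : E2 →L[ℝ] E3 :=
  mfderiv 𝓘(ℝ, E2) 𝓘(ℝ, E3) α p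

/-- The unit normal `N = α_u ∧ α_v / |α_u ∧ α_v|`, computed in the preferred chart `(u, v)` at `p`.
For an oriented atlas it does not depend on the chart. -/
noncomputable def unitNormal (α : M → E3) (p : M) : E3 :=
  (‖cross (diffAt α p e1) (diffAt α p e2)‖)⁻¹ • cross (diffAt α p e1) (diffAt α p e2)

/-- The first fundamental form `I(x, y) = ⟨Dα x, Dα y⟩`. -/
noncomputable def firstForm (α : M → E3) (p : M) (x y : E2) : ℝ :=
  inner ℝ (diffAt α p x) (diffAt α p y)

/-- The second fundamental form `II(x, y) = - ⟨DN x, Dα y⟩` (which is `⟨N, D²α (x, y)⟩`, since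
`⟨N, Dα y⟩ = 0`). -/
noncomputable def secondForm (α : M → E3) (p : M) (x y : E2) : ℝ :=
  - inner ℝ (diffAt (unitNormal α) p x) (diffAt α p y)

/-- The Gaussian curvature `K = (e g - f²) / (E G - F²)`. -/
noncomputable def gaussCurvature (α : M → E3) (p : M) : ℝ :=
  (secondForm α p e1 e1 * secondForm α p e2 e2 - secondForm α p e1 e2 ^ 2) /
    (firstForm α p e1 e1 * firstForm α p e2 e2 - firstForm α p e1 e2 ^ 2)

/-- The normal curvature `II(x, x) / I(x, x)` in the direction of the tangent vector `x`. -/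
noncomputable def normalCurvature (α : M → E3) (p : M) (x : E2) : ℝ :=
  secondForm α p x x / firstForm α p x x

/-- The geodesic torsion in the direction of `x`: the function `τ_g` of the Darboux equation
`N' = - k_n T - τ_g (N ∧ T)` along a curve with unit tangent `T = Dα x / |Dα x|`. -/
noncomputable def geodesicTorsion (α : M → E3) (p : M) (x : E2) : ℝ :=
  - inner ℝ (diffAt (unitNormal α) p x) (cross (unitNormal α p) (diffAt α p x)) /
    firstForm α p x x

/-- The tangent direction `x` at the elliptic point `p` belongs to the maximal geometric mean
curvature foliation: its normal curvature is `√K` and its geodesic torsion is positive. -/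
def IsMaximalDirection (α : M → E3) (p : M) (x : E2) : Prop :=
  x ≠ 0 ∧ 0 < gaussCurvature α p ∧ normalCurvature α p x = √(gaussCurvature α p) ∧
    0 < geodesicTorsion α p x

/-- The velocity of a curve `c` in `M`. -/
noncomputable def velocity (c : ℝ → M) (s : ℝ) : E2 :=
  (mfderiv 𝓘(ℝ, ℝ) 𝓘(ℝ, E2) c s : ℝ →L[ℝ] E2) 1

/-- `c` is a maximal geometric mean curvature cycle of `α` of length `L`, parametrized by arc
length: a simple closed integral curve of the maximal geometric mean curvature foliation. -/
structure IsMaximalCycle (α : M → E3) (c : ℝ → M) (L : ℝ) : Prop where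
  contMDiff : ContMDiff 𝓘(ℝ, ℝ) 𝓘(ℝ, E2) 1 c
  unit_speed : ∀ s, ‖diffAt α (c s) (velocity c s)‖ = 1
  direction : ∀ s, IsMaximalDirection α (c s) (velocity c s)
  length_pos : 0 < L
  periodic : Function.Periodic c L
  injOn : InjOn c (Ico 0 L)

/-- The unit tangent `T(s)` of the curve `α ∘ c`, for `c` parametrized by arc length. -/
noncomputable def tangent (α : M → E3) (c : ℝ → M) (s : ℝ) : E3 :=
  diffAt α (c s) (velocity c s)

/-- A tubular chart `(s, v) ↦ φ (s, v)`, `|v| < η`, with `s` taken modulo `L`, around the closed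
curve `c`, in which
`α(s, v) = c(s) + v (N ∧ T)(s) + W(s, v) N(s)`.
The height `W` is determined by `φ`; as `v = 0` is the curve `c`, Taylor's formula at `v = 0` gives
`W(s, v) = (2 H - √K)(s) v² / 2 + A(s) v³ / 6 + v³ B(s, v)`, `B(s, 0) = 0`; this expansion is not
assumed. -/
structure IsTubularChart (n : WithTop ℕ∞) (α : M → E3) (c : ℝ → M) (L η : ℝ)
    (φ : ℝ × ℝ → M) : Prop where
  width_pos : 0 < η
  contMDiffOn : ContMDiffOn 𝓘(ℝ, ℝ × ℝ) 𝓘(ℝ, E2) n φ (univ ×ˢ Ioo (-η) η)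
  regular : ∀ s, ∀ v ∈ Ioo (-η) η,
    Function.Injective (mfderiv 𝓘(ℝ, ℝ × ℝ) 𝓘(ℝ, E2) φ (s, v))
  eq_iff : ∀ s s', ∀ v ∈ Ioo (-η) η, ∀ v' ∈ Ioo (-η) η,
    (φ (s, v) = φ (s', v') ↔ v = v' ∧ ∃ k : ℤ, s' = s + k * L)
  axis : ∀ s, φ (s, 0) = c s
  normal_form : ∀ s, ∀ v ∈ Ioo (-η) η, ∃ w : ℝ,
    α (φ (s, v)) = α (c s) + v • cross (unitNormal α (c s)) (tangent α c s)
      + w • unitNormal α (c s)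

/-- The bump `(τ_g(s) v³ / 6) δ(v) N(s)` as a field on `M`: it has this value at `φ (s, v)`,
`|v| < η`, and vanishes outside the image of the tubular chart. -/
noncomputable def bump (α : M → E3) (c : ℝ → M) (η : ℝ) (φ : ℝ × ℝ → M) (δ : ℝ → ℝ) : M → E3 :=
  Function.extend
    (fun z : {z : ℝ × ℝ // z.2 ∈ Ioo (-η) η} => φ z.1)
    (fun z => (geodesicTorsion α (c z.1.1) (velocity c z.1.1) / 6 * z.1.2 ^ 3 * δ z.1.2) •
      unitNormal α (c z.1.1))
    (fun _ => 0)

/-- The deformation `β_ε = α + ε (τ_g v³ / 6) δ(v) N` of `α`. -/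
noncomputable def deformation (α : M → E3) (c : ℝ → M) (η : ℝ) (φ : ℝ × ℝ → M) (δ : ℝ → ℝ)
    (ε : ℝ) (p : M) : E3 :=
  α p + ε • bump α c η φ δ p

/-- `π` is (a representative near `0` of the germ of) the Poincaré return map of the maximal
geometric mean curvature foliation of `β`, along the cycle `v = 0`, on the cross section `s = 0` of
the tubular chart `φ`: for small `v₀`, the leaf through `φ (0, v₀)` is followed along
`s ↦ φ (s, v s)`, `v 0 = v₀`, in the direction of increasing `s`, until it meets the section again
at `s = L`, at the point `φ (L, π v₀) = φ (0, π v₀)`. -/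
def IsReturnMap (β : M → E3) (L η : ℝ) (φ : ℝ × ℝ → M) (π : ℝ → ℝ) : Prop :=
  π 0 = 0 ∧ ∀ᶠ v₀ in 𝓝 (0 : ℝ), ∃ v : ℝ → ℝ, ContDiff ℝ 1 v ∧ v 0 = v₀ ∧ v L = π v₀ ∧
    ∀ s ∈ Icc 0 L, v s ∈ Ioo (-η) η ∧
      IsMaximalDirection β (φ (s, v s)) (velocity (fun t => φ (t, v t)) s)

/-- The maximal cycle `c` of `β` is hyperbolic: its return map has at the fixed point a derivative
different from `1`. -/
def IsHyperbolicMaximalCycle (β : M → E3) (c : ℝ → M) (L η : ℝ) (φ : ℝ × ℝ → M) : Prop :=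
  IsMaximalCycle β c L ∧
    ∃ π : ℝ → ℝ, IsReturnMap β L η φ π ∧ DifferentiableAt ℝ π 0 ∧ deriv π 0 ≠ 1

end Surface

end GMC

namespace GMC

/-! ### Return maps of scalar equations `v' = F (s, v)` along the solution `v = 0`. -/

section ReturnMap

/-! Near the cycle the maximal lines are graphs `v(s)` solving `dv/ds = p(s, v)`, where `p` is the
small root of `(e - kE) + 2(f - kF)p + (g - kG)p² = 0` and `k = √K` is computed from the same
coefficients. Since `p(s, 0) = 0`, linearizing along `v = 0` gives `ln π'(0) = ∫₀ᴸ p_v(s, 0) ds`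
(`exists_return_map`).

On the axis the frame `φ_s, φ_v` is `T, N ∧ T`, so `E = G = 1`, `F = 0`, `e = k`, `f = τ_g`.
Differentiating the quadratic there gives `p_v = -(e_v - k_v - e E_v) / (2 τ_g)`
(`hasDerivAt_slopeRoot`), in which `g_v` enters only through `k_v`, with coefficient `e / (2e) =
1/2`.

The bump is of order `v³`, so along `c` the deformation keeps the 2-jet of `α`. Thus `c` remains a
maximal cycle, and the `v`-derivatives of `E, F, G, e, f` do not change. The factor `τ_g / 6` is
chosen so that `g_v` increases by exactly `ε τ_g`; then `k_v` increases by `ε τ_g / 2` and `p_v` by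
`ε / 4` (`hasDerivAt_slope_deformation`). Hence `ln π_ε'(0) = C + ε L / 4` exactly for small `ε`,
with `C` the value for `α`. This gives the derivative, and it is nonzero for all small `ε ≠ 0`,
whether or not `C = 0`.

The remaining work is regularity. The deformation has to be of class `C^(r-2)`, although `τ_g` is
defined with the velocity of `c`: an expression of `τ_g` by the two curvatures avoids losing a
derivative. Strict inequalities on the axis, with compactness of one period, make everything hold on
a uniform strip. -/

lemma eventually_forall_Icc_of_axis {L : ℝ} {P : ℝ × ℝ → Prop}
    (hP : ∀ s ∈ Icc 0 L, ∀ᶠ z in 𝓝 ((s, 0) : ℝ × ℝ), P z) :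
    ∃ ρ > 0, ∀ s ∈ Icc 0 L, ∀ v, |v| ≤ ρ → P (s, v) := by
  have h : ∀ᶠ v in 𝓝 (0 : ℝ), ∀ s ∈ Icc 0 L, P (s, v) := by
    refine isCompact_Icc.eventually_forall_of_forall_eventually (fun s hs => ?_)
    have h1 : Tendsto (fun z : ℝ × ℝ => (z.2, z.1)) (𝓝 (0, s)) (𝓝 (s, 0)) :=
      (continuous_snd.prodMk continuous_fst).tendsto (0, s)
    simpa using h1.eventually (hP s hs)
  obtain ⟨ρ, hρ, h⟩ := Metric.eventually_nhds_iff.1 h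
  refine ⟨ρ / 2, by positivity, fun s hs v hv => h ?_ s hs⟩
  rw [Real.dist_eq, sub_zero]
  linarith

/-- Solutions of `v' = F (s, v)` near the solution `v = 0` on `[0, L]`, with the exponential
estimate. -/
lemma exists_solution_near_axis {F : ℝ × ℝ → ℝ} {L ρ K : ℝ} (hL : 0 < L) (hρ : 0 < ρ) (hK : 0 ≤ K)
    (hF : ∀ s ∈ Icc 0 L, ∀ v, |v| ≤ ρ → ContDiffAt ℝ 1 F (s, v))
    (hb : ∀ s ∈ Icc 0 L, ∀ v, |v| ≤ ρ → |fderiv ℝ F (s, v) (0, 1)| ≤ K)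
    (h0 : ∀ s ∈ Icc 0 L, F (s, 0) = 0) {v₀ : ℝ} (hv₀ : |v₀| * Real.exp (K * L) ≤ ρ) :
    ∃ v : ℝ → ℝ, ContDiff ℝ 1 v ∧ v 0 = v₀ ∧ ∀ s ∈ Icc 0 L,
      |v s| ≤ |v₀| * Real.exp (K * L) ∧ HasDerivAt v (F (s, v s)) s := by
  have hρ' : -ρ ≤ ρ := by linarith
  -- `F` is controlled only for `|v| ≤ ρ`. Clamping `v` gives a bounded, globally Lipschitz field;
  -- the Gronwall bound and `hv₀` show afterwards that the solution never feels the clamp.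
  set pr : ℝ → ℝ := fun v => (projIcc (-ρ) ρ hρ' v : ℝ) with hpr
  have hprm : ∀ v, |pr v| ≤ ρ := fun v => abs_le.2 (projIcc (-ρ) ρ hρ' v).2
  have hprid : ∀ v, |v| ≤ ρ → pr v = v := fun v hv => by
    simp only [hpr]
    rw [projIcc_of_mem hρ' (abs_le.1 hv)]
  have hprc : Continuous pr := continuous_subtype_val.comp continuous_projIcc
  lift K to NNReal using hK
  have hlipF : ∀ s ∈ Icc 0 L, LipschitzOnWith K (fun v => F (s, v)) (Icc (-ρ) ρ) := by
    intro s hs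
    refine (convex_Icc _ _).lipschitzOnWith_of_nnnorm_hasDerivWithin_le
      (f' := fun v => fderiv ℝ F (s, v) (0, 1)) (fun v hv => ?_) (fun v hv => ?_)
    · have h1 := ((hF s hs v (abs_le.2 hv)).differentiableAt one_ne_zero).hasFDerivAt
      have h2 : HasDerivAt (fun v : ℝ => ((s, v) : ℝ × ℝ)) (0, 1) v :=
        (hasDerivAt_const v s).prodMk (hasDerivAt_id v)
      exact (h1.comp_hasDerivAt v h2).hasDerivWithinAt
    · have := hb s hs v (abs_le.2 hv)
      rw [← Real.norm_eq_abs] at this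
      exact_mod_cast this
  set G : ℝ → ℝ → ℝ := fun s v => F (s, pr v) with hG
  have hGlip : ∀ s ∈ Icc 0 L, LipschitzWith K (G s) := by
    intro s hs
    have h1 : LipschitzWith 1 pr := (LipschitzWith.subtype_val _).comp
      (LipschitzWith.projIcc hρ') |>.weaken (by simp)
    have := (hlipF s hs).comp (h1.lipschitzOnWith (s := univ))
      (fun v _ => abs_le.1 (hprm v))
    rw [mul_one] at this
    exact lipschitzOnWith_univ.1 this
  have hGb : ∀ s ∈ Icc 0 L, ∀ v, |G s v| ≤ K * ρ := by
    intro s hs v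
    have := (hlipF s hs).dist_le_mul _ (abs_le.1 (hprm v)) 0 ⟨by linarith, hρ.le⟩
    simp only [h0 s hs, Real.dist_eq, sub_zero] at this
    exact this.trans (mul_le_mul_of_nonneg_left (hprm v) K.2)
  have hGc : ContinuousOn (fun z : ℝ × ℝ => G z.1 z.2) (Icc 0 L ×ˢ univ) := by
    intro z hz
    have h1 : ContinuousAt F (z.1, pr z.2) := (hF z.1 hz.1 _ (hprm _)).continuousAt
    have h2 : ContinuousAt (fun z : ℝ × ℝ => (z.1, pr z.2)) z := by fun_prop
    exact (ContinuousAt.comp (f := fun z : ℝ × ℝ => (z.1, pr z.2)) h1 h2).continuousWithinAt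
  -- The radius `K * ρ * L` is the speed bound times the duration, so one application covers all of
  -- `[0, L]`.
  have hPL : IsPicardLindelof G (⟨0, ⟨le_rfl, hL.le⟩⟩ : Icc 0 L) v₀
      (⟨K * ρ * L, by positivity⟩) 0 ⟨K * ρ, by positivity⟩ K := by
    refine ⟨fun t ht => (hGlip t ht).lipschitzOnWith, fun x _ => ?_, fun t ht x _ => ?_, ?_⟩
    · exact hGc.comp (f := fun t => (t, x)) (by fun_prop) (fun t ht => ⟨ht, mem_univ _⟩)
    · exact hGb t ht x
    · simp only [sub_zero, sub_self, NNReal.coe_zero, max_eq_left hL.le]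
      exact le_rfl
  obtain ⟨w, hw0, hw⟩ := hPL.exists_eq_forall_mem_Icc_hasDerivWithinAt₀
  simp only at hw0
  have hwc : ContinuousOn w (Icc 0 L) := fun t ht => (hw t ht).continuousWithinAt
  have hwb : ∀ s ∈ Icc 0 L, |w s| ≤ |v₀| * Real.exp (K * L) := by
    intro s hs
    have h1 := norm_le_gronwallBound_of_norm_deriv_right_le (f := w) (f' := fun t => G t (w t))
      (K := K) (ε := 0) (δ := |v₀|) hwc (fun t ht => ?_) (by simp [hw0]) (fun t ht => ?_) s hs
    · rw [gronwallBound_ε0, Real.norm_eq_abs] at h1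
      refine h1.trans (mul_le_mul_of_nonneg_left ?_ (abs_nonneg _))
      exact Real.exp_le_exp.2 (mul_le_mul_of_nonneg_left (by linarith [hs.2]) K.2)
    · exact (hw t ⟨ht.1, ht.2.le⟩).mono_of_mem_nhdsWithin
        (Icc_mem_nhdsGE_of_mem ht)
    · have := (hGlip t ⟨ht.1, ht.2.le⟩).dist_le_mul (w t) 0
      have h00 : G t 0 = 0 := by
        simp only [hG]
        rw [hprid 0 (by simpa using hρ.le), h0 t ⟨ht.1, ht.2.le⟩]
      simpa [h00, Real.dist_eq] using this
  -- `w` is a solution on `[0, L]` only. Freezing its derivative beyond the endpoints and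
  -- integrating extends it to a `C^1` function on the line, with two-sided derivatives at `0` and
  -- `L`.
  set q : ℝ → ℝ := fun t => F (projIcc 0 L hL.le t, w (projIcc 0 L hL.le t)) with hq
  have hqG : ∀ t ∈ Icc 0 L, q t = G t (w t) := by
    intro t ht
    simp only [hq, hG, projIcc_of_mem hL.le ht]
    rw [hprid _ ((hwb t ht).trans hv₀)]
  have hqc : Continuous q := by
    have h1 : ContinuousOn (fun t => G t (w t)) (Icc 0 L) :=
      hGc.comp (f := fun t => (t, w t)) (continuousOn_id.prodMk hwc) (fun t ht => ⟨ht, mem_univ _⟩)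
    have h2 := h1.comp_continuous (f := fun t => (projIcc 0 L hL.le t : ℝ))
      (continuous_subtype_val.comp continuous_projIcc) (fun t => (projIcc 0 L hL.le t).2)
    refine h2.congr (fun t => ?_)
    simp only [hq, hG, Function.comp_apply]
    rw [hprid _ ((hwb _ (projIcc 0 L hL.le t).2).trans hv₀)]
  set v : ℝ → ℝ := fun s => v₀ + ∫ t in (0 : ℝ)..s, q t with hv
  have hvd : ∀ s, HasDerivAt v (q s) s := fun s =>
    (intervalIntegral.integral_hasDerivAt_right (hqc.intervalIntegrable _ _)
      (hqc.stronglyMeasurableAtFilter _ _) hqc.continuousAt).const_add v₀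
  have hvw : ∀ s ∈ Icc 0 L, v s = w s := by
    intro s hs
    have := intervalIntegral.integral_eq_sub_of_hasDeriv_right_of_le (f := w) (f' := q) hs.1
      (hwc.mono (Icc_subset_Icc_right hs.2)) (fun t ht => ?_) (hqc.intervalIntegrable _ _)
    · simp only [hv, this, hw0]
      ring
    · have htL : t ∈ Icc 0 L := ⟨ht.1.le, ht.2.le.trans hs.2⟩
      rw [hqG t htL]
      have hn : Icc 0 L ∈ 𝓝 t := Icc_mem_nhds ht.1 (ht.2.trans_le hs.2)
      exact ((hw t htL).hasDerivAt hn).hasDerivWithinAt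
  refine ⟨v, ?_, by simp [hv], fun s hs => ⟨by rw [hvw s hs]; exact hwb s hs, ?_⟩⟩
  · rw [contDiff_one_iff_deriv]
    refine ⟨fun s => (hvd s).differentiableAt, ?_⟩
    rw [show deriv v = q from funext fun s => (hvd s).deriv]
    exact hqc
  · have := hvd s
    rw [hqG s hs] at this
    simp only [hG] at this
    rwa [hprid _ ((hwb s hs).trans hv₀), ← hvw s hs] at this

/-- The return map of `v' = F (s, v)` along the periodic solution `v = 0`; its derivative at `0` is
the exponential of the integral of `∂F/∂v (s, 0)`. -/
theorem exists_return_map {F : ℝ × ℝ → ℝ} {L : ℝ} (hL : 0 < L)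
    (hF : ∀ s ∈ Icc 0 L, ContDiffAt ℝ 1 F (s, 0)) (h0 : ∀ s ∈ Icc 0 L, F (s, 0) = 0)
    {P : ℝ × ℝ → Prop} (hP : ∀ s ∈ Icc 0 L, ∀ᶠ z in 𝓝 ((s, 0) : ℝ × ℝ), P z) :
    ∃ π : ℝ → ℝ, π 0 = 0 ∧
      (∀ᶠ v₀ in 𝓝 (0 : ℝ), ∃ v : ℝ → ℝ, ContDiff ℝ 1 v ∧ v 0 = v₀ ∧ v L = π v₀ ∧
        ∀ s ∈ Icc 0 L, P (s, v s) ∧ HasDerivAt v (F (s, v s)) s) ∧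
      HasDerivAt π (Real.exp (∫ s in (0 : ℝ)..L, fderiv ℝ F (s, 0) (0, 1))) 0 := by
  set D : ℝ × ℝ → ℝ := fun z => fderiv ℝ F z (0, 1) with hD
  have hDc : ∀ s ∈ Icc 0 L, ContinuousAt D (s, 0) := fun s hs =>
    ((hF s hs).fderiv_right (m := 0) (by simp)).continuousAt.clm_apply continuousAt_const
  have hclose : ∀ κ > 0, ∀ s ∈ Icc 0 L, ∀ᶠ z in 𝓝 ((s, 0) : ℝ × ℝ), |D z - D (z.1, 0)| ≤ κ := by
    intro κ hκ s hs
    have h1 : ContinuousAt (fun z : ℝ × ℝ => D (z.1, 0)) (s, 0) :=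
      ContinuousAt.comp (x := ((s, 0) : ℝ × ℝ)) (f := fun z : ℝ × ℝ => (z.1, (0 : ℝ)))
        (g := D) (hDc s hs) (by fun_prop)
    have h2 : Tendsto (fun z : ℝ × ℝ => |D z - D (z.1, 0)|) (𝓝 (s, 0)) (𝓝 0) := by
      simpa using ((hDc s hs).sub h1).abs.tendsto
    exact (h2.eventually (gt_mem_nhds hκ)).mono fun z hz => hz.le
  have hac : ContinuousOn (fun s => D (s, 0)) (Icc 0 L) := fun s hs =>
    (ContinuousAt.comp (f := fun s : ℝ => (s, (0 : ℝ))) (hDc s hs)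
      (by fun_prop)).continuousWithinAt
  obtain ⟨K₀, hK₀⟩ := isCompact_Icc.exists_bound_of_continuousOn hac
  have hK₀0 : 0 ≤ K₀ := (norm_nonneg _).trans (hK₀ 0 ⟨le_rfl, hL.le⟩)
  have hFe : ∀ s ∈ Icc 0 L, ∀ᶠ z in 𝓝 ((s, 0) : ℝ × ℝ), ContDiffAt ℝ 1 F z := fun s hs =>
    (hF s hs).eventually (by simp)
  obtain ⟨ρ, hρ, hρP⟩ := eventually_forall_Icc_of_axis
    (fun s hs => (hFe s hs).and ((hclose 1 one_pos s hs).and (hP s hs)))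
  -- `K₀` bounds `∂F/∂v` on the axis; the `1` is the oscillation allowed on the strip by `hclose 1`.
  set K := K₀ + 1 with hKdef
  have hsol : ∀ v₀ : ℝ, |v₀| * Real.exp (K * L) ≤ ρ → ∃ v : ℝ → ℝ, ContDiff ℝ 1 v ∧ v 0 = v₀ ∧
      ∀ s ∈ Icc 0 L, |v s| ≤ |v₀| * Real.exp (K * L) ∧ HasDerivAt v (F (s, v s)) s := by
    intro v₀ hv₀
    refine exists_solution_near_axis hL hρ (by positivity) (fun s hs v hv => (hρP s hs v hv).1)
      (fun s hs v hv => ?_) h0 hv₀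
    have h1 := (hρP s hs v hv).2.1
    have h2 := hK₀ s hs
    rw [Real.norm_eq_abs] at h2
    calc |D (s, v)| = |(D (s, v) - D (s, 0)) + D (s, 0)| := by ring_nf
      _ ≤ |D (s, v) - D (s, 0)| + |D (s, 0)| := abs_add_le _ _
      _ ≤ K := by simp only at h1; linarith
  choose! sol hsol1 hsol2 hsol3 using hsol
  have hsmall : ∀ ρ' > 0, ∀ᶠ v₀ in 𝓝 (0 : ℝ), |v₀| * Real.exp (K * L) ≤ ρ' := by
    intro ρ' hρ'
    have : Tendsto (fun v₀ : ℝ => |v₀| * Real.exp (K * L)) (𝓝 0) (𝓝 0) := by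
      have : Continuous (fun v₀ : ℝ => |v₀| * Real.exp (K * L)) := by fun_prop
      simpa using this.tendsto 0
    exact (this.eventually (gt_mem_nhds hρ')).mono fun z hz => hz.le
  set a : ℝ → ℝ := fun s => D (projIcc 0 L hL.le s, 0) with ha
  have hac' : Continuous a := hac.comp_continuous
    (f := fun t => (projIcc 0 L hL.le t : ℝ))
    (continuous_subtype_val.comp continuous_projIcc) (fun t => (projIcc 0 L hL.le t).2)
  have haD : ∀ s ∈ Icc 0 L, a s = D (s, 0) := fun s hs => by
    simp only [ha, projIcc_of_mem hL.le hs]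
  set A : ℝ → ℝ := fun s => ∫ t in (0 : ℝ)..s, a t with hA
  have hAd : ∀ s, HasDerivAt A (a s) s := fun s =>
    intervalIntegral.integral_hasDerivAt_right (hac'.intervalIntegrable _ _)
      (hac'.stronglyMeasurableAtFilter _ _) hac'.continuousAt
  have hAL : ∫ s in (0 : ℝ)..L, D (s, 0) = A L := by
    refine intervalIntegral.integral_congr (fun s hs => ?_)
    rw [uIcc_of_le hL.le] at hs
    exact (haD s hs).symm
  have hAc : Continuous A := continuous_iff_continuousAt.2 fun s => (hAd s).continuousAt
  obtain ⟨C, hC⟩ := isCompact_Icc.exists_bound_of_continuousOn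
    (Real.continuous_exp.comp hAc.neg).continuousOn (s := Icc 0 L)
  have hCpos : 0 ≤ C := (norm_nonneg _).trans (hC 0 ⟨le_rfl, hL.le⟩)
  have hsol0 : sol 0 L = 0 := by
    have h1 := (hsol3 0 (by simpa using hρ.le) L ⟨hL.le, le_rfl⟩).1
    simpa using h1
  refine ⟨fun v₀ => sol v₀ L, hsol0, ?_, ?_⟩
  · filter_upwards [hsmall ρ hρ] with v₀ hv₀
    exact ⟨sol v₀, hsol1 v₀ hv₀, hsol2 v₀ hv₀, rfl, fun s hs =>
      ⟨(hρP s hs _ (((hsol3 v₀ hv₀ s hs).1).trans hv₀)).2.2, (hsol3 v₀ hv₀ s hs).2⟩⟩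
  · rw [hAL, hasDerivAt_iff_isLittleO_nhds_zero, Asymptotics.isLittleO_iff]
    intro κ' hκ'
    -- `B * κ * |v₀|` is the error of the integrating-factor estimate below; `κ` is divided by `B +
    -- 1` because `B` may vanish.
    set B := Real.exp (A L) * (Real.exp (K * L) * C * L) with hB
    have hB0 : 0 ≤ B := by positivity
    set κ := κ' / (B + 1) with hκdef
    have hκ : 0 < κ := by positivity
    have hκB : B * κ ≤ κ' := by
      rw [hκdef, mul_div_assoc', div_le_iff₀ (by positivity)]
      nlinarith
    obtain ⟨ρ', hρ', hρκ⟩ := eventually_forall_Icc_of_axis (hclose κ hκ)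
    filter_upwards [hsmall ρ hρ, hsmall ρ' hρ'] with v₀ hv₀ hv₀'
    simp only [zero_add, hsol0, sub_zero, smul_eq_mul, Real.norm_eq_abs]
    set v := sol v₀ with hvdef
    have hest : ∀ s ∈ Icc 0 L, |F (s, v s) - a s * v s| ≤ κ * |v s| := by
      intro s hs
      have hvs := (hsol3 v₀ hv₀ s hs).1
      have h1 := (convex_Icc (-|v s|) |v s|).norm_image_sub_le_of_norm_hasDerivWithin_le
        (f := fun y => F (s, y) - a s * y) (f' := fun y => D (s, y) - a s) (C := κ)
        (x := 0) (y := v s) (fun y hy => ?_) (fun y hy => ?_)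
        ⟨by simp, by simp⟩ ⟨neg_abs_le _, le_abs_self _⟩
      · simpa [h0 s hs] using h1
      · have h1 := ((hρP s hs y ((abs_le.2 hy).trans (hvs.trans hv₀))).1.differentiableAt
          one_ne_zero).hasFDerivAt
        have h2 : HasDerivAt (fun v : ℝ => ((s, v) : ℝ × ℝ)) (0, 1) y :=
          (hasDerivAt_const y s).prodMk (hasDerivAt_id y)
        have h3 := (h1.comp_hasDerivAt y h2).sub ((hasDerivAt_id y).const_mul (a s))
        rw [mul_one] at h3
        exact h3.hasDerivWithinAt
      · rw [haD s hs]
        exact hρκ s hs y ((abs_le.2 hy).trans (hvs.trans hv₀'))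
    -- Integrating factor: `v e^(-A)` has derivative `(F - a v) e^(-A)`, which is at most a small
    -- multiple of `|v₀|` by `hest`.
    have hmain := (convex_Icc 0 L).norm_image_sub_le_of_norm_hasDerivWithin_le
      (f := fun s => v s * Real.exp (-A s))
      (f' := fun s => (F (s, v s) - a s * v s) * Real.exp (-A s))
      (C := κ * (|v₀| * Real.exp (K * L)) * C)
      (x := 0) (y := L) (fun s hs => ?_) (fun s hs => ?_) ⟨le_rfl, hL.le⟩ ⟨hL.le, le_rfl⟩
    · have hv0 : v 0 = v₀ := hsol2 v₀ hv₀
      have hA0 : A 0 = 0 := by simp [hA]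
      simp only [hA0, hv0, neg_zero, Real.exp_zero, mul_one, Real.norm_eq_abs, sub_zero,
        abs_of_pos hL] at hmain
      have hfac : v L - v₀ * Real.exp (A L)
          = Real.exp (A L) * (v L * Real.exp (-A L) - v₀) := by
        rw [Real.exp_neg]
        field_simp
      rw [hfac, abs_mul, abs_of_pos (Real.exp_pos _)]
      calc Real.exp (A L) * |v L * Real.exp (-A L) - v₀|
          ≤ Real.exp (A L) * (κ * (|v₀| * Real.exp (K * L)) * C * L) :=
            mul_le_mul_of_nonneg_left hmain (Real.exp_pos _).le
        _ = (B * κ) * |v₀| := by rw [hB]; ring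
        _ ≤ κ' * |v₀| := mul_le_mul_of_nonneg_right hκB (abs_nonneg _)
    · have h1 := ((hsol3 v₀ hv₀ s hs).2.mul ((hAd s).neg.exp)).hasDerivWithinAt (s := Icc 0 L)
      refine h1.congr_deriv ?_
      simp only [Pi.neg_apply]
      ring
    · rw [norm_mul]
      refine mul_le_mul ((hest s hs).trans ?_) (hC s hs) (norm_nonneg _) (by positivity)
      exact mul_le_mul_of_nonneg_left (hsol3 v₀ hv₀ s hs).1 hκ.le

end ReturnMap

/-! ### The quadratic equation for the slope, and its first-order variation. -/

section SlopeRoot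

/-- For `k = √K`, with `K` the Gaussian curvature of the forms `(E, F, G)` and `(e, f, g)`, the root
`p` near `0` of `(e - k E) + 2 (f - k F) p + (g - k G) p ^ 2 = 0` when `f - k F > 0`. -/
noncomputable def slopeRoot (e f g E F G : ℝ) : ℝ :=
  -(e - √((e * g - f ^ 2) / (E * G - F ^ 2)) * E) /
    ((f - √((e * g - f ^ 2) / (E * G - F ^ 2)) * F) +
      √((f - √((e * g - f ^ 2) / (E * G - F ^ 2)) * F) ^ 2 -
        (g - √((e * g - f ^ 2) / (E * G - F ^ 2)) * G) *
          (e - √((e * g - f ^ 2) / (E * G - F ^ 2)) * E)))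

/-- The rationalized form of `(-b + √(b² - ac)) / a`: it needs no `a ≠ 0`, and it picks the branch
that vanishes with `c`. -/
lemma quadratic_root {a b c : ℝ} (hb : 0 < b) (hd : 0 ≤ b ^ 2 - a * c) :
    c + 2 * b * (-c / (b + √(b ^ 2 - a * c))) + a * (-c / (b + √(b ^ 2 - a * c))) ^ 2 = 0 := by
  have hS := Real.sq_sqrt hd
  set S := √(b ^ 2 - a * c)
  have h0 : b + S ≠ 0 := by positivity
  field_simp
  linear_combination c * hS

lemma slopeRoot_spec {e f g E F G : ℝ}
    (hb : 0 < f - √((e * g - f ^ 2) / (E * G - F ^ 2)) * F)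
    (hd : 0 ≤ (f - √((e * g - f ^ 2) / (E * G - F ^ 2)) * F) ^ 2 -
        (g - √((e * g - f ^ 2) / (E * G - F ^ 2)) * G) *
          (e - √((e * g - f ^ 2) / (E * G - F ^ 2)) * E)) :
    e + 2 * f * slopeRoot e f g E F G + g * slopeRoot e f g E F G ^ 2 =
      √((e * g - f ^ 2) / (E * G - F ^ 2)) *
        (E + 2 * F * slopeRoot e f g E F G + G * slopeRoot e f g E F G ^ 2) := by
  have h := quadratic_root hb hd
  rw [show -(e - √((e * g - f ^ 2) / (E * G - F ^ 2)) * E) /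
    ((f - √((e * g - f ^ 2) / (E * G - F ^ 2)) * F) +
      √((f - √((e * g - f ^ 2) / (E * G - F ^ 2)) * F) ^ 2 -
        (g - √((e * g - f ^ 2) / (E * G - F ^ 2)) * G) *
          (e - √((e * g - f ^ 2) / (E * G - F ^ 2)) * E))) = slopeRoot e f g E F G from rfl] at h
  linear_combination h

/-- In an orthonormal frame whose first vector has normal curvature `√K`, the constant term `e - kE`
is zero. This makes `v = 0` a solution of the slope equation. -/
lemma slopeRoot_of_principal {e f g : ℝ} (he : e = √(e * g - f ^ 2)) :
    slopeRoot e f g 1 0 1 = 0 := by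
  simp [slopeRoot, ← he]

variable {V : Type*} [NormedAddCommGroup V] [NormedSpace ℝ V]

/-- At such a point the discriminant is `f²` and the denominator `2f`, and `K > 0`: every square
root and quotient is taken away from its singularity. -/
lemma contDiffAt_slopeRoot {n : WithTop ℕ∞} {e f g E F G : V → ℝ} {z : V}
    (he : ContDiffAt ℝ n e z) (hf : ContDiffAt ℝ n f z) (hg : ContDiffAt ℝ n g z)
    (hE : ContDiffAt ℝ n E z) (hF : ContDiffAt ℝ n F z) (hG : ContDiffAt ℝ n G z)
    (hE1 : E z = 1) (hF0 : F z = 0) (hG1 : G z = 1) (hK : 0 < e z * g z - f z ^ 2)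
    (hek : e z = √(e z * g z - f z ^ 2)) (hf0 : 0 < f z) :
    ContDiffAt ℝ n (fun z => slopeRoot (e z) (f z) (g z) (E z) (F z) (G z)) z := by
  have hd : E z * G z - F z ^ 2 ≠ 0 := by rw [hE1, hF0, hG1]; norm_num
  have hk : ContDiffAt ℝ n (fun z => √((e z * g z - f z ^ 2) / (E z * G z - F z ^ 2))) z := by
    refine ContDiffAt.sqrt (((he.mul hg).sub (hf.pow 2)).div ((hE.mul hG).sub (hF.pow 2)) hd) ?_
    rw [hE1, hF0, hG1]
    simpa using hK.ne'
  have hkz : √((e z * g z - f z ^ 2) / (E z * G z - F z ^ 2)) = e z := by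
    rw [hE1, hF0, hG1]
    simpa using hek.symm
  have hb := hf.sub (hk.mul hF)
  have hc := he.sub (hk.mul hE)
  have ha := hg.sub (hk.mul hG)
  refine ContDiffAt.div hc.neg (hb.add (ContDiffAt.sqrt ((hb.pow 2).sub (ha.mul hc)) ?_)) ?_
  · rw [hkz, hE1, hF0]
    simpa using hf0.ne'
  · rw [hkz, hE1, hF0]
    have : 0 ≤ √((f z - e z * 0) ^ 2 - (g z - e z * G z) * (e z - e z * 1)) := Real.sqrt_nonneg _
    have : 0 < f z - e z * 0 + √((f z - e z * 0) ^ 2 - (g z - e z * G z) * (e z - e z * 1)) := by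
      linarith
    exact this.ne'

/-- The numerator `-(e - kE)` vanishes at `v`, so the derivative is that of the numerator over `2f`;
variations of the denominator drop out. As `F = 0` and `E = G = 1`, the variation of `EG - F²` is
`E' + G'`, and `k' = K' / (2e)` because `k = e`. -/
lemma hasDerivAt_slopeRoot {e f g E F G : ℝ → ℝ} {e' f' g' E' F' G' v : ℝ}
    (he : HasDerivAt e e' v) (hf : HasDerivAt f f' v) (hg : HasDerivAt g g' v)
    (hE : HasDerivAt E E' v) (hF : HasDerivAt F F' v) (hG : HasDerivAt G G' v)
    (hE1 : E v = 1) (hF0 : F v = 0) (hG1 : G v = 1) (hK : 0 < e v * g v - f v ^ 2)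
    (hek : e v = √(e v * g v - f v ^ 2)) (hf0 : 0 < f v) :
    HasDerivAt (fun v => slopeRoot (e v) (f v) (g v) (E v) (F v) (G v))
      (-(e' - (e' * g v + e v * g' - 2 * f v * f' - (e v * g v - f v ^ 2) * (E' + G')) /
        (2 * e v) - e v * E') / (2 * f v)) v := by
  have hd : E v * G v - F v ^ 2 ≠ 0 := by rw [hE1, hF0, hG1]; norm_num
  have hkz : √((e v * g v - f v ^ 2) / (E v * G v - F v ^ 2)) = e v := by
    rw [hE1, hF0, hG1]
    simpa using hek.symm
  have hk := HasDerivAt.sqrt (((he.mul hg).sub (hf.pow 2)).div ((hE.mul hG).sub (hF.pow 2)) hd) (by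
    simp only [Pi.sub_apply, Pi.mul_apply, Pi.pow_apply, Pi.div_apply]
    rw [hE1, hF0, hG1]
    simpa using hK.ne')
  simp only [Pi.sub_apply, Pi.mul_apply, Pi.pow_apply, Pi.div_apply] at hk
  rw [hkz] at hk
  have hb := hf.sub (hk.mul hF)
  have hc := he.sub (hk.mul hE)
  have ha := hg.sub (hk.mul hG)
  have hS := HasDerivAt.sqrt ((hb.pow 2).sub (ha.mul hc)) (by
    simp only [Pi.sub_apply, Pi.mul_apply, Pi.pow_apply]
    rw [hkz, hE1, hF0]
    simpa using hf0.ne')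
  have h := (hc.neg).div (hb.add hS) (by
    simp only [Pi.sub_apply, Pi.mul_apply, Pi.pow_apply, Pi.add_apply]
    rw [hkz, hE1, hF0]
    have : 0 ≤ √((f v - e v * 0) ^ 2 - (g v - e v * G v) * (e v - e v * 1)) := Real.sqrt_nonneg _
    have : 0 < f v - e v * 0 + √((f v - e v * 0) ^ 2 - (g v - e v * G v) * (e v - e v * 1)) := by
      linarith
    exact this.ne')
  have he0 : 0 < e v := by rw [hek]; exact Real.sqrt_pos.2 hK
  refine (h.congr_of_eventuallyEq (Eventually.of_forall fun _ => rfl)).congr_deriv ?_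
  simp only [Pi.sub_apply, Pi.mul_apply, Pi.pow_apply, Pi.add_apply, Pi.neg_apply]
  rw [hkz, hE1, hF0, hG1]
  have hs : √((f v - e v * 0) ^ 2 - (g v - e v * 1) * (e v - e v * 1)) = f v := by
    rw [show (f v - e v * 0) ^ 2 - (g v - e v * 1) * (e v - e v * 1) = f v ^ 2 by ring]
    exact Real.sqrt_sq hf0.le
  rw [hs]
  have hf1 := hf0.ne'
  have he1 := he0.ne'
  generalize f v = x at *
  generalize e v = y at *
  simp only [Nat.reduceSub, pow_one, Nat.cast_ofNat, mul_zero, sub_zero, mul_one, one_pow,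
    sub_self, neg_zero, zero_mul, zero_pow two_ne_zero, div_one, zero_add, one_mul]
  field_simp
  ring

end SlopeRoot

/-! ### Identities and smoothness of the vector product. -/

section Cross

lemma inner_eq (x y : E3) : inner ℝ x y = x 0 * y 0 + x 1 * y 1 + x 2 * y 2 := by
  simp [PiLp.inner_apply, Fin.sum_univ_three]
  ring

@[simp] lemma cross_zero' (x y : E3) : cross x y 0 = x 1 * y 2 - x 2 * y 1 := by
  simp [cross, cross_apply]

@[simp] lemma cross_one' (x y : E3) : cross x y 1 = x 2 * y 0 - x 0 * y 2 := by
  simp [cross, cross_apply]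

@[simp] lemma cross_two' (x y : E3) : cross x y 2 = x 0 * y 1 - x 1 * y 0 := by
  simp [cross, cross_apply]

lemma E3_ext {x y : E3} (h0 : x 0 = y 0) (h1 : x 1 = y 1) (h2 : x 2 = y 2) : x = y := by
  ext i
  fin_cases i <;> assumption

lemma cross_linearComb (x y : E3) (a b c d : ℝ) :
    cross (a • x + b • y) (c • x + d • y) = (a * d - b * c) • cross x y := by
  apply E3_ext <;> simp <;> ring

lemma inner_cross_left (x y : E3) : inner ℝ (cross x y) x = 0 := by
  simp [inner_eq]; ring

lemma inner_cross_right (x y : E3) : inner ℝ (cross x y) y = 0 := by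
  simp [inner_eq]; ring

lemma inner_cross_self_cross (x y : E3) : inner ℝ (cross x y) (cross x y) =
    inner ℝ x x * inner ℝ y y - inner ℝ x y ^ 2 := by
  simp only [inner_eq, cross_zero', cross_one', cross_two']; ring

lemma cross_cross_left (x y : E3) : cross x (cross y x) = inner ℝ x x • y - inner ℝ x y • x := by
  apply E3_ext <;> simp only [PiLp.sub_apply, PiLp.smul_apply, smul_eq_mul, inner_eq, cross_zero',
    cross_one', cross_two'] <;> ring

/-- The vector product as a bilinear continuous map. -/
noncomputable def crossL : E3 →L[ℝ] E3 →L[ℝ] E3 :=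
  LinearMap.toContinuousLinearMap
    { toFun := fun x => LinearMap.toContinuousLinearMap
        { toFun := fun y => cross x y
          map_add' := fun y z => by apply E3_ext <;> simp <;> ring
          map_smul' := fun a y => by apply E3_ext <;> simp <;> ring }
      map_add' := fun x y => by
        ext z : 1
        apply E3_ext <;> simp <;> ring
      map_smul' := fun a x => by
        ext z : 1
        apply E3_ext <;> simp <;> ring }

@[simp] lemma crossL_apply (x y : E3) : crossL x y = cross x y := rfl

lemma contDiffAt_cross {V : Type*} [NormedAddCommGroup V] [NormedSpace ℝ V] {n : WithTop ℕ∞}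
    {u w : V → E3} {z : V} (hu : ContDiffAt ℝ n u z) (hw : ContDiffAt ℝ n w z) :
    ContDiffAt ℝ n (fun z => cross (u z) (w z)) z :=
  ((crossL.contDiff.contDiffAt.comp z hu).clm_apply hw :
    ContDiffAt ℝ n (fun z => crossL (u z) (w z)) z)

lemma continuousAt_cross {X : Type*} [TopologicalSpace X]
    {u w : X → E3} {z : X} (hu : ContinuousAt u z) (hw : ContinuousAt w z) :
    ContinuousAt (fun z => cross (u z) (w z)) z :=
  ((crossL.continuous.continuousAt.comp hu).clm_apply hw :
    ContinuousAt (fun z => crossL (u z) (w z)) z)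

end Cross

/-! ### The unit normal of a linear immersion. -/

section NormalVector

/-- If `x ∧ y = 0`, then `x ∧ (y ∧ x) = |x|² y - ⟨x, y⟩ x` is a linear relation between `x` and `y`,
which forces `x = 0`. -/
lemma cross_ne_zero {x y : E3} (h : ∀ a b : ℝ, a • x + b • y = 0 → a = 0 ∧ b = 0) :
    cross x y ≠ 0 := by
  intro h0
  have h1 : cross y x = 0 := by
    apply E3_ext <;> [have := congrArg (fun z : E3 => z 0) h0; have := congrArg (fun z : E3 => z 1) h0;
      have := congrArg (fun z : E3 => z 2) h0] <;> simp at this ⊢ <;> linarith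
  have h2 := cross_cross_left x y
  rw [h1] at h2
  have h3 : cross x 0 = 0 := by apply E3_ext <;> simp
  rw [h3] at h2
  have h4 := h (-inner ℝ x y) (inner ℝ x x) (by rw [h2]; module)
  have hx : x = 0 := inner_self_eq_zero.1 h4.2
  have := (h 1 0 (by simp [hx])).1
  exact one_ne_zero this

/-- The unit vector normal to the image of `A`. -/
noncomputable def normalOf (A : E2 →L[ℝ] E3) : E3 :=
  (‖cross (A e1) (A e2)‖)⁻¹ • cross (A e1) (A e2)

lemma E2_eq (x : E2) : x = x 0 • e1 + x 1 • e2 := by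
  ext i
  fin_cases i <;> simp [e1, e2]

lemma E2_comb_eq_zero {a b : ℝ} (h : a • e1 + b • e2 = 0) : a = 0 ∧ b = 0 := by
  have h0 := congrArg (fun z : E2 => z 0) h
  have h1 := congrArg (fun z : E2 => z 1) h
  simp [e1, e2] at h0 h1
  exact ⟨h0, h1⟩

lemma cross_ne_zero_of_injective {A : E2 →L[ℝ] E3} (hA : Function.Injective A) :
    cross (A e1) (A e2) ≠ 0 := by
  refine cross_ne_zero fun a b h => E2_comb_eq_zero (hA ?_)
  simpa using h

lemma det_E2 (J : E2 →L[ℝ] E2) : J.det = (J e1) 0 * (J e2) 1 - (J e2) 0 * (J e1) 1 := by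
  have hb : (J : E2 →ₗ[ℝ] E2).det = Matrix.det (LinearMap.toMatrix
    (EuclideanSpace.basisFun (Fin 2) ℝ).toBasis (EuclideanSpace.basisFun (Fin 2) ℝ).toBasis
      (J : E2 →ₗ[ℝ] E2)) := (LinearMap.det_toMatrix _ _).symm
  rw [ContinuousLinearMap.det, hb, Matrix.det_fin_two]
  simp [LinearMap.toMatrix_apply, e1, e2]

/-- The vector product is multiplied by `det J`, and normalization removes a positive factor. The
orientation of the atlas serves here. -/
lemma normalOf_comp {A : E2 →L[ℝ] E3} {J : E2 →L[ℝ] E2} (hJ : 0 < J.det) :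
    normalOf (A.comp J) = normalOf A := by
  have h : cross (A (J e1)) (A (J e2)) = J.det • cross (A e1) (A e2) := by
    rw [E2_eq (J e1), E2_eq (J e2), map_add, map_add, map_smul, map_smul, map_smul, map_smul,
      cross_linearComb, det_E2]
    congr 1
    ring
  simp only [normalOf, ContinuousLinearMap.comp_apply, h]
  rw [norm_smul, Real.norm_of_nonneg hJ.le, smul_smul, mul_inv]
  congr 1
  field_simp

lemma contDiffAt_normalOf {V : Type*} [NormedAddCommGroup V] [NormedSpace ℝ V] {n : WithTop ℕ∞}
    {A : V → E2 →L[ℝ] E3} {z : V} (hA : ContDiffAt ℝ n A z) (hinj : Function.Injective (A z)) :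
    ContDiffAt ℝ n (fun z => normalOf (A z)) z := by
  have h := contDiffAt_cross (hA.clm_apply (contDiffAt_const (c := e1)))
    (hA.clm_apply (contDiffAt_const (c := e2)))
  have h0 := cross_ne_zero_of_injective hinj
  exact ((h.norm ℝ h0).inv (norm_ne_zero_iff.2 h0)).smul h

lemma norm_normalOf {A : E2 →L[ℝ] E3} (hA : Function.Injective A) : ‖normalOf A‖ = 1 := by
  have h0 := norm_ne_zero_iff.2 (cross_ne_zero_of_injective hA)
  rw [normalOf, norm_smul, norm_inv, norm_norm, inv_mul_cancel₀ h0]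

lemma inner_normalOf (A : E2 →L[ℝ] E3) (x : E2) : inner ℝ (normalOf A) (A x) = 0 := by
  rw [E2_eq x, map_add, map_smul, map_smul, normalOf, inner_smul_left, inner_add_right,
    inner_smul_right, inner_smul_right, inner_cross_left, inner_cross_right]
  simp

end NormalVector

/-! ### Passing from the preferred chart at each point to a fixed chart. -/

section Charts

variable {M : Type*} [TopologicalSpace M] [ChartedSpace E2 M]

lemma unitNormal_eq (α : M → E3) (p : M) : unitNormal α p = normalOf (diffAt α p) := rfl

lemma IsImmersionOfClass.injective_diffAt {n : WithTop ℕ∞} {α : M → E3}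
    (h : IsImmersionOfClass n α) (p : M) : Function.Injective (diffAt α p) := h.injective p

lemma IsImmersionOfClass.norm_unitNormal {n : WithTop ℕ∞} {α : M → E3}
    (h : IsImmersionOfClass n α) (p : M) : ‖unitNormal α p‖ = 1 := norm_normalOf (h.injective p)

lemma inner_unitNormal_diffAt (α : M → E3) (p : M) (x : E2) :
    inner ℝ (unitNormal α p) (diffAt α p x) = 0 := inner_normalOf _ _

variable {P : Type*} [NormedAddCommGroup P] [NormedSpace ℝ P]

/-- The derivative of a parametrization of the surface. -/
noncomputable def paramDeriv (ψ : P → M) (q : P) : P →L[ℝ] E2 :=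
  mfderiv 𝓘(ℝ, P) 𝓘(ℝ, E2) ψ q

lemma diffAt_paramDeriv {β : M → E3} {ψ : P → M} {q : P}
    (hβ : MDifferentiableAt 𝓘(ℝ, E2) 𝓘(ℝ, E3) β (ψ q))
    (hψ : MDifferentiableAt 𝓘(ℝ, P) 𝓘(ℝ, E2) ψ q) (x : P) :
    diffAt β (ψ q) (paramDeriv ψ q x) = fderiv ℝ (β ∘ ψ) q x := by
  have h := mfderiv_comp q hβ hψ
  rw [mfderiv_eq_fderiv] at h
  exact (DFunLike.congr_fun h x).symm

variable [IsManifold 𝓘(ℝ, E2) ∞ M]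

/-- The preferred chart at `p` may jump with `p`, so `diffAt` is not continuous in `p` by itself.
`J` is the Jacobian of the change to a fixed chart, of positive determinant by orientation. -/
lemma exists_diffAt_eq_comp (hM : IsOrientedAtlas M) {β : M → E3} {p : M}
    {e : OpenPartialHomeomorph M E2} (he : e ∈ atlas E2 M) (hp : p ∈ e.source)
    (hβ : MDifferentiableAt 𝓘(ℝ, E2) 𝓘(ℝ, E3) β p) :
    ∃ J : E2 →L[ℝ] E2, 0 < J.det ∧ diffAt β p = (fderiv ℝ (β ∘ e.symm) (e p)).comp J := by
  have hmd := mdifferentiable_of_mem_atlas (I := 𝓘(ℝ, E2)) he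
  have hep : MDifferentiableAt 𝓘(ℝ, E2) 𝓘(ℝ, E2) e p := hmd.mdifferentiableAt hp
  have hes : MDifferentiableAt 𝓘(ℝ, E2) 𝓘(ℝ, E2) e.symm (e p) :=
    hmd.mdifferentiableAt_symm (e.map_source hp)
  refine ⟨fderiv ℝ ((chartAt E2 p).symm.trans e) (chartAt E2 p p), ?_, ?_⟩
  · refine hM _ (chart_mem_atlas E2 p) e he _ ?_
    simp [hp]
  · have h1 : mfderiv 𝓘(ℝ, E2) 𝓘(ℝ, E2) e p
        = fderiv ℝ ((chartAt E2 p).symm.trans e) (chartAt E2 p p) := by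
      rw [hep.mfderiv]
      simp [writtenInExtChartAt, fderivWithin_univ, Function.comp_def, chartAt_self_eq]
      rfl
    rw [← h1]
    have hβ' : MDifferentiableAt 𝓘(ℝ, E2) 𝓘(ℝ, E3) β (e.symm (e p)) := by
      rwa [e.left_inv hp]
    have h2 : MDifferentiableAt 𝓘(ℝ, E2) 𝓘(ℝ, E3) (β ∘ e.symm) (e p) := hβ'.comp _ hes
    have h3 := mfderiv_comp p h2 hep
    rw [mfderiv_eq_fderiv] at h3
    refine Eq.trans (Filter.EventuallyEq.mfderiv_eq (I := 𝓘(ℝ, E2)) (I' := 𝓘(ℝ, E3)) ?_) h3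
    filter_upwards [e.open_source.mem_nhds hp] with y hy
    simp [e.left_inv hy]

lemma unitNormal_eq_chart (hM : IsOrientedAtlas M) {β : M → E3} {p : M}
    {e : OpenPartialHomeomorph M E2} (he : e ∈ atlas E2 M) (hp : p ∈ e.source)
    (hβ : MDifferentiableAt 𝓘(ℝ, E2) 𝓘(ℝ, E3) β p) :
    unitNormal β p = normalOf (fderiv ℝ (β ∘ e.symm) (e p)) := by
  obtain ⟨J, hJ, h⟩ := exists_diffAt_eq_comp hM he hp hβ
  rw [unitNormal_eq, h, normalOf_comp hJ]

lemma contMDiffAt_chart_symm' {e : OpenPartialHomeomorph M E2} (he : e ∈ atlas E2 M) {p : M}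
    (hp : p ∈ e.source) {n : WithTop ℕ∞} (hn : n ≤ ∞) :
    ContMDiffAt 𝓘(ℝ, E2) 𝓘(ℝ, E2) n e.symm (e p) :=
  (contMDiffAt_symm_of_mem_maximalAtlas (IsManifold.subset_maximalAtlas he)
    (e.map_source hp)).of_le hn

/-- The unit normal of an immersion of class `C^n` is of class `C^m` if `m + 1 ≤ n`. -/
lemma IsImmersionOfClass.contMDiff_unitNormal (hM : IsOrientedAtlas M) {β : M → E3}
    {n m : WithTop ℕ∞} (h : IsImmersionOfClass n β) (hmn : m + 1 ≤ n) (hn : n ≤ ∞) :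
    ContMDiff 𝓘(ℝ, E2) 𝓘(ℝ, E3) m (unitNormal β) := by
  intro p
  have hn1 : n ≠ 0 := by
    rintro rfl
    simp at hmn
  have hmd : MDifferentiable 𝓘(ℝ, E2) 𝓘(ℝ, E3) β := h.contMDiff.mdifferentiable hn1
  set e := chartAt E2 p with he
  have heA : e ∈ atlas E2 M := chart_mem_atlas E2 p
  have hp : p ∈ e.source := mem_chart_source E2 p
  have hβ : ContDiffAt ℝ n (β ∘ e.symm) (e p) := by
    rw [← contMDiffAt_iff_contDiffAt]
    exact (h.contMDiff _).comp _ (contMDiffAt_chart_symm' heA hp hn)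
  have hinj : Function.Injective (fderiv ℝ (β ∘ e.symm) (e p)) := by
    have hes : MDifferentiableAt 𝓘(ℝ, E2) 𝓘(ℝ, E2) e.symm (e p) :=
      (mdifferentiable_of_mem_atlas heA).mdifferentiableAt_symm (e.map_source hp)
    have h1 : Function.Injective (paramDeriv e.symm (e p)) :=
      (mdifferentiable_of_mem_atlas (I := 𝓘(ℝ, E2)) heA).symm.mfderiv_injective (e.map_source hp)
    have h2 := (h.injective_diffAt (e.symm (e p))).comp h1
    rwa [show diffAt β (e.symm (e p)) ∘ paramDeriv e.symm (e p)
      = fderiv ℝ (β ∘ e.symm) (e p) from funext fun x => diffAt_paramDeriv (hmd _) hes x] at h2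
  have h1 : ContDiffAt ℝ m (fun q => normalOf (fderiv ℝ (β ∘ e.symm) q)) (e p) :=
    contDiffAt_normalOf (hβ.fderiv_right hmn) hinj
  have hm : m ≤ ∞ := (self_le_add_right m 1).trans (hmn.trans hn)
  have h2 : ContMDiffAt 𝓘(ℝ, E2) 𝓘(ℝ, E2) m e p :=
    (contMDiffAt_of_mem_maximalAtlas (IsManifold.subset_maximalAtlas heA) hp).of_le hm
  refine (ContMDiffAt.comp p h1.contMDiffAt h2).congr_of_eventuallyEq ?_
  filter_upwards [e.open_source.mem_nhds hp] with y hy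
  exact unitNormal_eq_chart hM heA hy (hmd y)

end Charts

/-! ### Fundamental forms in an arbitrary parametrization. -/

section Forms

variable {M : Type*} [TopologicalSpace M] [ChartedSpace E2 M]
variable {P : Type*} [NormedAddCommGroup P] [NormedSpace ℝ P]
variable {β : M → E3} {n : WithTop ℕ∞} {ψ : P → M} {q : P}

lemma IsImmersionOfClass.contDiffAt_comp {k : WithTop ℕ∞} (h : IsImmersionOfClass n β)
    (hk : k ≤ n) (hψ : ContMDiffAt 𝓘(ℝ, P) 𝓘(ℝ, E2) k ψ q) : ContDiffAt ℝ k (β ∘ ψ) q := by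
  rw [← contMDiffAt_iff_contDiffAt]
  exact ((h.contMDiff _).of_le hk).comp _ hψ

lemma IsImmersionOfClass.mdifferentiableAt (h : IsImmersionOfClass n β) (hn : 1 ≤ n) (p : M) :
    MDifferentiableAt 𝓘(ℝ, E2) 𝓘(ℝ, E3) β p :=
  (h.contMDiff p).mdifferentiableAt (fun h0 => by simp [h0] at hn)

lemma secondForm_comb (α : M → E3) (p : M) (a b c d : ℝ) (x y z w : E2) :
    secondForm α p (a • x + b • y) (c • z + d • w) =
      a * c * secondForm α p x z + a * d * secondForm α p x w + b * c * secondForm α p y z +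
        b * d * secondForm α p y w := by
  simp only [secondForm, map_add, map_smul, inner_add_left, inner_add_right, inner_smul_left,
    inner_smul_right, conj_trivial]
  ring

lemma firstForm_comb (α : M → E3) (p : M) (a b c d : ℝ) (x y z w : E2) :
    firstForm α p (a • x + b • y) (c • z + d • w) =
      a * c * firstForm α p x z + a * d * firstForm α p x w + b * c * firstForm α p y z +
        b * d * firstForm α p y w := by
  simp only [firstForm, map_add, map_smul, inner_add_left, inner_add_right, inner_smul_left,
    inner_smul_right, conj_trivial]
  ring

lemma firstForm_symm (α : M → E3) (p : M) (x y : E2) : firstForm α p x y = firstForm α p y x :=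
  real_inner_comm _ _

/-- From `(u ∧ v) ∧ w = ⟨u, w⟩ v - ⟨v, w⟩ u`, which exhibits `N ∧ Dα x` as a tangent vector. -/
lemma exists_diffAt_eq_cross (α : M → E3) (p : M) (x : E2) :
    ∃ y, diffAt α p y = cross (unitNormal α p) (diffAt α p x) := by
  refine ⟨(‖cross (diffAt α p e1) (diffAt α p e2)‖)⁻¹ •
    (inner ℝ (diffAt α p e1) (diffAt α p x) • e2 - inner ℝ (diffAt α p e2) (diffAt α p x) • e1), ?_⟩
  rw [unitNormal]
  simp only [map_sub, map_smul]
  generalize diffAt α p e1 = u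
  generalize diffAt α p e2 = v
  generalize diffAt α p x = w
  generalize (‖cross u v‖)⁻¹ = t
  apply E3_ext <;> simp only [PiLp.sub_apply, PiLp.smul_apply, smul_eq_mul, inner_eq, cross_zero',
    cross_one', cross_two'] <;> ring

lemma IsImmersionOfClass.diffAt_paramDeriv (h : IsImmersionOfClass n β) (hn : 1 ≤ n)
    (hψ : ContMDiffAt 𝓘(ℝ, P) 𝓘(ℝ, E2) 1 ψ q) (x : P) :
    diffAt β (ψ q) (paramDeriv ψ q x) = fderiv ℝ (β ∘ ψ) q x :=
  GMC.diffAt_paramDeriv (h.mdifferentiableAt hn _) (hψ.mdifferentiableAt one_ne_zero) x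

lemma IsImmersionOfClass.firstForm_paramDeriv (h : IsImmersionOfClass n β) (hn : 1 ≤ n)
    (hψ : ContMDiffAt 𝓘(ℝ, P) 𝓘(ℝ, E2) 1 ψ q) (x y : P) :
    firstForm β (ψ q) (paramDeriv ψ q x) (paramDeriv ψ q y) =
      inner ℝ (fderiv ℝ (β ∘ ψ) q x) (fderiv ℝ (β ∘ ψ) q y) := by
  rw [firstForm, h.diffAt_paramDeriv hn hψ, h.diffAt_paramDeriv hn hψ]

lemma IsImmersionOfClass.inner_unitNormal_fderiv (h : IsImmersionOfClass n β) (hn : 1 ≤ n)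
    (hψ : ContMDiffAt 𝓘(ℝ, P) 𝓘(ℝ, E2) 1 ψ q) (x : P) :
    inner ℝ (unitNormal β (ψ q)) (fderiv ℝ (β ∘ ψ) q x) = 0 := by
  rw [← h.diffAt_paramDeriv hn hψ, inner_unitNormal_diffAt]

variable [IsManifold 𝓘(ℝ, E2) ∞ M]

lemma IsImmersionOfClass.diffAt_unitNormal_paramDeriv (hM : IsOrientedAtlas M)
    (h : IsImmersionOfClass n β) (hn : 2 ≤ n) (hn' : n ≤ ∞)
    (hψ : ContMDiffAt 𝓘(ℝ, P) 𝓘(ℝ, E2) 1 ψ q) (x : P) :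
    diffAt (unitNormal β) (ψ q) (paramDeriv ψ q x) = fderiv ℝ (unitNormal β ∘ ψ) q x := by
  have h1 : ContMDiff 𝓘(ℝ, E2) 𝓘(ℝ, E3) 1 (unitNormal β) :=
    h.contMDiff_unitNormal hM (by rwa [one_add_one_eq_two]) hn'
  exact GMC.diffAt_paramDeriv ((h1 _).mdifferentiableAt one_ne_zero)
    (hψ.mdifferentiableAt one_ne_zero) x

lemma IsImmersionOfClass.secondForm_paramDeriv' (hM : IsOrientedAtlas M)
    (h : IsImmersionOfClass n β) (hn : 2 ≤ n) (hn' : n ≤ ∞)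
    (hψ : ContMDiffAt 𝓘(ℝ, P) 𝓘(ℝ, E2) 1 ψ q) (x y : P) :
    secondForm β (ψ q) (paramDeriv ψ q x) (paramDeriv ψ q y) =
      - inner ℝ (fderiv ℝ (unitNormal β ∘ ψ) q x) (fderiv ℝ (β ∘ ψ) q y) := by
  rw [secondForm, h.diffAt_paramDeriv (one_le_two.trans hn) hψ,
    h.diffAt_unitNormal_paramDeriv hM hn hn' hψ]

lemma IsImmersionOfClass.contDiffAt_unitNormal_comp (hM : IsOrientedAtlas M)
    (h : IsImmersionOfClass n β) {k : WithTop ℕ∞} (hk : k + 1 ≤ n) (hn' : n ≤ ∞)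
    (hψ : ContMDiffAt 𝓘(ℝ, P) 𝓘(ℝ, E2) k ψ q) : ContDiffAt ℝ k (unitNormal β ∘ ψ) q := by
  rw [← contMDiffAt_iff_contDiffAt]
  exact ((h.contMDiff_unitNormal hM hk hn') _).comp _ hψ

/-- `⟨N_x, β_y⟩ = - ⟨N, β_xy⟩`. -/
lemma IsImmersionOfClass.inner_fderiv_unitNormal (hM : IsOrientedAtlas M)
    (h : IsImmersionOfClass n β) (hn : 2 ≤ n) (hn' : n ≤ ∞)
    (hψ : ContMDiffAt 𝓘(ℝ, P) 𝓘(ℝ, E2) 2 ψ q) (x y : P) :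
    inner ℝ (fderiv ℝ (unitNormal β ∘ ψ) q x) (fderiv ℝ (β ∘ ψ) q y) =
      - inner ℝ (unitNormal β (ψ q)) (fderiv ℝ (fderiv ℝ (β ∘ ψ)) q x y) := by
  have hb := h.contDiffAt_comp hn hψ
  have hN : ContDiffAt ℝ 1 (unitNormal β ∘ ψ) q :=
    h.contDiffAt_unitNormal_comp hM (by rwa [one_add_one_eq_two]) hn' (hψ.of_le one_le_two)
  have h1 : HasFDerivAt (fderiv ℝ (β ∘ ψ)) (fderiv ℝ (fderiv ℝ (β ∘ ψ)) q) q :=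
    ((hb.fderiv_right (m := 1) (by norm_num)).differentiableAt one_ne_zero).hasFDerivAt
  have h2 : HasFDerivAt (fun q => fderiv ℝ (β ∘ ψ) q y)
      ((fderiv ℝ (fderiv ℝ (β ∘ ψ)) q).flip y) q := by
    simpa using h1.clm_apply (hasFDerivAt_const y q)
  have h3 := ((hN.differentiableAt one_ne_zero).hasFDerivAt.inner ℝ h2)
  -- The identity to differentiate is `⟨N, β_y⟩ = 0`, which holds on a neighborhood.
  have h4 : (fun q => inner ℝ ((unitNormal β ∘ ψ) q) (fderiv ℝ (β ∘ ψ) q y)) =ᶠ[𝓝 q]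
      fun _ => 0 := by
    have : IsManifold 𝓘(ℝ, E2) 1 M := IsManifold.of_le (n := ∞) (by simp)
    filter_upwards [(contMDiffAt_iff_contMDiffAt_nhds (by simp)).1 (hψ.of_le one_le_two)] with q' hq'
    exact h.inner_unitNormal_fderiv (one_le_two.trans hn) hq' y
  have h5 := DFunLike.congr_fun (h3.unique ((hasFDerivAt_const (0 : ℝ) q).congr_of_eventuallyEq h4)) x
  simp at h5
  linarith

lemma IsImmersionOfClass.secondForm_paramDeriv (hM : IsOrientedAtlas M)
    (h : IsImmersionOfClass n β) (hn : 2 ≤ n) (hn' : n ≤ ∞)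
    (hψ : ContMDiffAt 𝓘(ℝ, P) 𝓘(ℝ, E2) 2 ψ q) (x y : P) :
    secondForm β (ψ q) (paramDeriv ψ q x) (paramDeriv ψ q y) =
      inner ℝ (unitNormal β (ψ q)) (fderiv ℝ (fderiv ℝ (β ∘ ψ)) q x y) := by
  rw [h.secondForm_paramDeriv' hM hn hn' (hψ.of_le one_le_two),
    h.inner_fderiv_unitNormal hM hn hn' hψ, neg_neg]

lemma paramDeriv_chart_symm_bijective {e : OpenPartialHomeomorph M E2} (he : e ∈ atlas E2 M) {p : M}
    (hp : p ∈ e.source) : Function.Bijective (paramDeriv e.symm (e p)) :=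
  (mdifferentiable_of_mem_atlas (I := 𝓘(ℝ, E2)) he).symm.mfderiv_bijective (e.map_source hp)

/-- Defined by `-⟨DN x, Dβ y⟩`, the form is not visibly symmetric; in a chart it is `⟨N, β_xy⟩`, and
second derivatives commute. -/
lemma IsImmersionOfClass.secondForm_symm (hM : IsOrientedAtlas M)
    (h : IsImmersionOfClass n β) (hn : 2 ≤ n) (hn' : n ≤ ∞) (p : M) (x y : E2) :
    secondForm β p x y = secondForm β p y x := by
  set e := chartAt E2 p with he
  have heA : e ∈ atlas E2 M := chart_mem_atlas E2 p
  have hp : p ∈ e.source := mem_chart_source E2 p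
  have hc := contMDiffAt_chart_symm' heA hp (n := 2) (WithTop.coe_le_coe.2 le_top)
  obtain ⟨x', rfl⟩ := (paramDeriv_chart_symm_bijective heA hp).2 x
  obtain ⟨y', rfl⟩ := (paramDeriv_chart_symm_bijective heA hp).2 y
  have h1 := h.secondForm_paramDeriv hM hn hn' hc x' y'
  have h2 := h.secondForm_paramDeriv hM hn hn' hc y' x'
  rw [e.left_inv hp] at h1 h2
  rw [h1, h2]
  have hb : ContDiffAt ℝ 2 (β ∘ e.symm) (e p) := h.contDiffAt_comp hn hc
  rw [(hb.isSymmSndFDerivAt (by simp)).eq]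

/-- Twice the mean curvature, `(e G - 2 f F + g E) / (E G - F²)`. -/
noncomputable def meanTrace (α : M → E3) (p : M) : ℝ :=
  (secondForm α p e1 e1 * firstForm α p e2 e2 - 2 * secondForm α p e1 e2 * firstForm α p e1 e2 +
    secondForm α p e2 e2 * firstForm α p e1 e1) /
    (firstForm α p e1 e1 * firstForm α p e2 e2 - firstForm α p e1 e2 ^ 2)

lemma det_ne_zero_of_independent {x y : E2}
    (h : ∀ a b : ℝ, a • x + b • y = 0 → a = 0 ∧ b = 0) : x 0 * y 1 - x 1 * y 0 ≠ 0 := by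
  intro h0
  have h1 := h (y 1) (-x 1) (by
    ext i
    fin_cases i <;> simp <;> linarith)
  have h2 := h (y 0) (-x 0) (by
    ext i
    fin_cases i <;> simp <;> linarith)
  have hx : x = 0 := by
    ext i
    fin_cases i
    · simpa using h2.2
    · simpa using h1.2
  exact one_ne_zero (h 1 0 (by simp [hx])).1

/-- A change of basis multiplies each numerator and denominator by the square of its determinant.
The curvatures can thus be read in the frame of the tubular chart. -/
lemma IsImmersionOfClass.curvatures_eq (hM : IsOrientedAtlas M)
    (h : IsImmersionOfClass n β) (hn : 2 ≤ n) (hn' : n ≤ ∞) (p : M) {x y : E2}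
    (hxy : ∀ a b : ℝ, a • x + b • y = 0 → a = 0 ∧ b = 0) :
    gaussCurvature β p =
      (secondForm β p x x * secondForm β p y y - secondForm β p x y ^ 2) /
        (firstForm β p x x * firstForm β p y y - firstForm β p x y ^ 2) ∧
    meanTrace β p =
      (secondForm β p x x * firstForm β p y y - 2 * secondForm β p x y * firstForm β p x y +
        secondForm β p y y * firstForm β p x x) /
        (firstForm β p x x * firstForm β p y y - firstForm β p x y ^ 2) := by
  have hd := pow_ne_zero 2 (det_ne_zero_of_independent hxy)
  have hs := h.secondForm_symm hM hn hn' p e2 e1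
  have hf := firstForm_symm β p e2 e1
  have hx := E2_eq x
  have hy := E2_eq y
  generalize x 0 = a at *
  generalize x 1 = b at *
  generalize y 0 = c at *
  generalize y 1 = d at *
  subst hx hy
  simp only [secondForm_comb, firstForm_comb, hs, hf]
  constructor
  · rw [gaussCurvature, ← mul_div_mul_left _ _ hd]
    congr 1 <;> ring
  · rw [meanTrace, ← mul_div_mul_left _ _ hd]
    congr 1 <;> ring

end Forms

/-! ### Regularity of the curvatures, and the forms in a maximal direction. -/

section Smoothness

variable {M : Type*} [TopologicalSpace M] [ChartedSpace E2 M] [IsManifold 𝓘(ℝ, E2) ∞ M]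
variable {α : M → E3} {n : WithTop ℕ∞}

/-- The Gaussian and the mean curvatures of an immersion of class `C^n` are of class `C^k` if
`k + 2 ≤ n`. -/
lemma IsImmersionOfClass.contMDiffAt_curvatures (hM : IsOrientedAtlas M)
    (h : IsImmersionOfClass n α) {k : WithTop ℕ∞} (hk : k + 2 ≤ n) (hn' : n ≤ ∞) (p : M) :
    ContMDiffAt 𝓘(ℝ, E2) 𝓘(ℝ, ℝ) k (gaussCurvature α) p ∧
      ContMDiffAt 𝓘(ℝ, E2) 𝓘(ℝ, ℝ) k (meanTrace α) p := by
  have hn : 2 ≤ n := (self_le_add_left 2 k).trans hk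
  have hk1 : k + 1 + 1 ≤ n := by rwa [add_assoc, one_add_one_eq_two]
  have hk1n : k + 1 ≤ n := (self_le_add_right (k + 1) 1).trans hk1
  have hkn : k ≤ n := (self_le_add_right k 1).trans hk1n
  set e := chartAt E2 p with he
  have heA : e ∈ atlas E2 M := chart_mem_atlas E2 p
  have hp : p ∈ e.source := mem_chart_source E2 p
  have hec := contMDiffAt_chart_symm' heA hp (le_refl _)
  set b := α ∘ e.symm
  set N := unitNormal α ∘ e.symm
  have hb : ContDiffAt ℝ k (fderiv ℝ b) (e p) :=
    (h.contDiffAt_comp hk1n (hec.of_le (hk1n.trans hn'))).fderiv_right le_rfl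
  have hN : ContDiffAt ℝ k (fderiv ℝ N) (e p) :=
    (h.contDiffAt_unitNormal_comp hM hk1 hn' (hec.of_le (hk1n.trans hn'))).fderiv_right le_rfl
  have hI : ∀ x y : E2, ContDiffAt ℝ k (fun q => inner ℝ (fderiv ℝ b q x) (fderiv ℝ b q y))
      (e p) := fun x y =>
    (hb.clm_apply contDiffAt_const).inner ℝ (hb.clm_apply contDiffAt_const)
  have hII : ∀ x y : E2, ContDiffAt ℝ k (fun q => -inner ℝ (fderiv ℝ N q x) (fderiv ℝ b q y))
      (e p) := fun x y =>
    ((hN.clm_apply contDiffAt_const).inner ℝ (hb.clm_apply contDiffAt_const)).neg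
  have hIeq : ∀ p' ∈ e.source, ∀ x y, firstForm α p' (paramDeriv e.symm (e p') x)
      (paramDeriv e.symm (e p') y) = inner ℝ (fderiv ℝ b (e p') x) (fderiv ℝ b (e p') y) := by
    intro p' hp' x y
    have := h.firstForm_paramDeriv (one_le_two.trans hn) (q := e p')
      (contMDiffAt_chart_symm' heA hp' (by simp)) x y
    rwa [e.left_inv hp'] at this
  have hIIeq : ∀ p' ∈ e.source, ∀ x y, secondForm α p' (paramDeriv e.symm (e p') x)
      (paramDeriv e.symm (e p') y) = -inner ℝ (fderiv ℝ N (e p') x) (fderiv ℝ b (e p') y) := by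
    intro p' hp' x y
    have := h.secondForm_paramDeriv' hM hn hn' (q := e p')
      (contMDiffAt_chart_symm' heA hp' (by simp)) x y
    rwa [e.left_inv hp'] at this
  have hind : ∀ p' ∈ e.source, ∀ a b : ℝ, a • paramDeriv e.symm (e p') e1 +
      b • paramDeriv e.symm (e p') e2 = 0 → a = 0 ∧ b = 0 := by
    intro p' hp' a b hab
    refine E2_comb_eq_zero ((paramDeriv_chart_symm_bijective heA hp').1 ?_)
    simpa using hab
  have hcurv := fun p' hp' => h.curvatures_eq hM hn hn' p' (hind p' hp')
  -- `EG - F²` is the squared norm of the vector product of the two partial derivatives, nonzero for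
  -- an immersion.
  have hd : inner ℝ (fderiv ℝ b (e p) e1) (fderiv ℝ b (e p) e1) *
      inner ℝ (fderiv ℝ b (e p) e2) (fderiv ℝ b (e p) e2) -
        inner ℝ (fderiv ℝ b (e p) e1) (fderiv ℝ b (e p) e2) ^ 2 ≠ 0 := by
    rw [← inner_cross_self_cross]
    refine fun h0 => cross_ne_zero_of_injective ?_ (inner_self_eq_zero.1 h0)
    have h2 := (h.injective_diffAt (e.symm (e p))).comp (paramDeriv_chart_symm_bijective heA hp).1
    rwa [show diffAt α (e.symm (e p)) ∘ paramDeriv e.symm (e p) = fderiv ℝ b (e p) from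
      funext fun x => h.diffAt_paramDeriv (one_le_two.trans hn) (hec.of_le (by simp)) x] at h2
  have hem : ContMDiffAt 𝓘(ℝ, E2) 𝓘(ℝ, E2) k e p :=
    (contMDiffAt_of_mem_maximalAtlas (IsManifold.subset_maximalAtlas heA) hp).of_le (hkn.trans hn')
  constructor
  · have h1 := ((((hII e1 e1).mul (hII e2 e2)).sub ((hII e1 e2).pow 2)).div
      (((hI e1 e1).mul (hI e2 e2)).sub ((hI e1 e2).pow 2)) hd).contMDiffAt
    refine (ContMDiffAt.comp p h1 hem).congr_of_eventuallyEq ?_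
    filter_upwards [e.open_source.mem_nhds hp] with p' hp'
    rw [(hcurv p' hp').1]
    simp only [hIeq p' hp', hIIeq p' hp']
    rfl
  · have h1 := (((((hII e1 e1).mul (hI e2 e2)).sub (((contDiffAt_const (c := (2 : ℝ))).mul
      (hII e1 e2)).mul (hI e1 e2))).add ((hII e2 e2).mul (hI e1 e1))).div
      (((hI e1 e1).mul (hI e2 e2)).sub ((hI e1 e2).pow 2)) hd).contMDiffAt
    refine (ContMDiffAt.comp p h1 hem).congr_of_eventuallyEq ?_
    filter_upwards [e.open_source.mem_nhds hp] with p' hp'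
    rw [(hcurv p' hp').2]
    simp only [hIeq p' hp', hIIeq p' hp']
    rfl

/-- In the orthonormal basis of a unit direction `x` and of the direction `y` of `N ∧ Dα x`, the
second fundamental form has the entries `√K`, `τ_g`. -/
lemma IsImmersionOfClass.forms_of_isMaximalDirection (hM : IsOrientedAtlas M)
    (h : IsImmersionOfClass n α) (hn : 2 ≤ n) (hn' : n ≤ ∞) {p : M} {x y : E2}
    (hx : ‖diffAt α p x‖ = 1) (hmax : IsMaximalDirection α p x)
    (hy : diffAt α p y = cross (unitNormal α p) (diffAt α p x)) :
    firstForm α p x x = 1 ∧ firstForm α p x y = 0 ∧ firstForm α p y y = 1 ∧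
      secondForm α p x x = √(gaussCurvature α p) ∧
      secondForm α p x y = geodesicTorsion α p x ∧
      gaussCurvature α p = secondForm α p x x * secondForm α p y y - secondForm α p x y ^ 2 ∧
      geodesicTorsion α p x = √(√(gaussCurvature α p) * meanTrace α p - 2 * gaussCurvature α p) := by
  obtain ⟨hx0, hK, hk, hτ⟩ := hmax
  have hE : firstForm α p x x = 1 := by
    rw [firstForm, real_inner_self_eq_norm_sq, hx, one_pow]
  have hF : firstForm α p x y = 0 := by
    rw [firstForm, hy, real_inner_comm, inner_cross_right]
  have hG : firstForm α p y y = 1 := by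
    rw [firstForm, hy, inner_cross_self_cross, inner_unitNormal_diffAt,
      real_inner_self_eq_norm_sq, real_inner_self_eq_norm_sq, hx, h.norm_unitNormal]
    norm_num
  have he : secondForm α p x x = √(gaussCurvature α p) := by
    rw [← hk, normalCurvature, hE, div_one]
  have hf : secondForm α p x y = geodesicTorsion α p x := by
    rw [geodesicTorsion, hE, div_one, secondForm, hy]
  have hind : ∀ a b : ℝ, a • x + b • y = 0 → a = 0 ∧ b = 0 := by
    intro a b hab
    have h1 := firstForm_comb α p a b 1 0 x y x y
    have h2 := firstForm_comb α p a b 0 1 x y x y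
    rw [hab] at h1 h2
    rw [firstForm_symm α p y x, hF, hE] at h1
    rw [hF, hG] at h2
    simp [firstForm] at h1 h2
    exact ⟨h1.symm, h2.symm⟩
  obtain ⟨hKe, hHe⟩ := h.curvatures_eq hM hn hn' p hind
  rw [hE, hF, hG] at hKe hHe
  norm_num at hKe hHe
  refine ⟨hE, hF, hG, he, hf, hKe, ?_⟩
  have hs := Real.sq_sqrt hK.le
  -- With `2H = √K + g` and `K = √K g - τ²`, one gets `√K · 2H - 2K = √K g - K = τ²`.
  refine (Real.sqrt_sq hτ.le).symm.trans (congrArg _ ?_)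
  rw [hHe, ← hf, ← he]
  rw [← he] at hs
  linarith

end Smoothness

/-! ### The tubular chart and the velocity of the cycle. -/

section Axis

variable {M : Type*} [TopologicalSpace M] [ChartedSpace E2 M]
variable {α : M → E3} {c : ℝ → M} {L η : ℝ} {φ : ℝ × ℝ → M}

lemma IsTubularChart.contMDiffAt {n : WithTop ℕ∞} (hφ : IsTubularChart n α c L η φ) {z : ℝ × ℝ}
    (hz : z.2 ∈ Ioo (-η) η) : ContMDiffAt 𝓘(ℝ, ℝ × ℝ) 𝓘(ℝ, E2) n φ z :=
  hφ.contMDiffOn.contMDiffAt ((isOpen_univ.prod isOpen_Ioo).mem_nhds ⟨mem_univ _, hz⟩)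

lemma IsTubularChart.zero_mem {n : WithTop ℕ∞} (hφ : IsTubularChart n α c L η φ) :
    (0 : ℝ) ∈ Ioo (-η) η := ⟨by linarith [hφ.width_pos], hφ.width_pos⟩

lemma IsTubularChart.injective_paramDeriv {n : WithTop ℕ∞} (hφ : IsTubularChart n α c L η φ)
    {z : ℝ × ℝ} (hz : z.2 ∈ Ioo (-η) η) : Function.Injective (paramDeriv φ z) :=
  hφ.regular z.1 z.2 hz

lemma IsTubularChart.bijective_paramDeriv {n : WithTop ℕ∞} (hφ : IsTubularChart n α c L η φ)
    {z : ℝ × ℝ} (hz : z.2 ∈ Ioo (-η) η) : Function.Bijective (paramDeriv φ z) := by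
  have h := hφ.injective_paramDeriv hz
  exact ⟨h, (LinearMap.injective_iff_surjective_of_finrank_eq_finrank
    (f := (paramDeriv φ z : ℝ × ℝ →ₗ[ℝ] E2)) (by simp)).1 h⟩

/-- The velocity of a curve given in a parametrization. -/
lemma velocity_param {v : ℝ → ℝ} {v' s : ℝ} (hv : HasDerivAt v v' s)
    (hφ : ContMDiffAt 𝓘(ℝ, ℝ × ℝ) 𝓘(ℝ, E2) 1 φ (s, v s)) :
    velocity (fun t => φ (t, v t)) s = paramDeriv φ (s, v s) (1, v') := by
  have h1 : HasDerivAt (fun t : ℝ => (t, v t)) ((1 : ℝ), v') s := (hasDerivAt_id s).prodMk hv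
  have h2 := h1.hasFDerivAt.hasMFDerivAt
  have h3 := HasMFDerivAt.comp s (hφ.mdifferentiableAt one_ne_zero).hasMFDerivAt h2
  have h4 := h3.mfderiv
  have h5 := DFunLike.congr_fun h4 (1 : ℝ)
  refine h5.trans ?_
  change paramDeriv φ (s, v s) ((1 : ℝ) • ((1 : ℝ), v')) = _
  rw [one_smul]

lemma IsTubularChart.velocity_axis {n : WithTop ℕ∞} (hn : 1 ≤ n)
    (hφ : IsTubularChart n α c L η φ) (s : ℝ) :
    velocity c s = paramDeriv φ (s, 0) (1, 0) := by
  rw [← velocity_param (v := fun _ => 0) (hasDerivAt_const s 0)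
    ((hφ.contMDiffAt (z := (s, 0)) hφ.zero_mem).of_le hn)]
  congr 1
  exact funext fun t => (hφ.axis t).symm

lemma IsMaximalCycle.velocity_periodic (hc : IsMaximalCycle α c L) :
    Function.Periodic (velocity c) L := by
  intro s
  have h1 : HasMFDerivAt 𝓘(ℝ, ℝ) 𝓘(ℝ, ℝ) (fun t : ℝ => t + L) s (ContinuousLinearMap.id ℝ ℝ) :=
    ((hasFDerivAt_id s).add_const L).hasMFDerivAt
  have h2 := HasMFDerivAt.comp s
    ((hc.contMDiff (s + L)).mdifferentiableAt one_ne_zero).hasMFDerivAt h1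
  have h3 : c ∘ (fun t : ℝ => t + L) = c := funext hc.periodic
  rw [h3] at h2
  exact (DFunLike.congr_fun h2.mfderiv (1 : ℝ)).symm

end Axis

/-! ### Testing regularity on the surface through a parametrization. -/

section InverseFunction

variable {M : Type*} [TopologicalSpace M] [ChartedSpace E2 M] [IsManifold 𝓘(ℝ, E2) ∞ M]
variable {P : Type*} [NormedAddCommGroup P] [NormedSpace ℝ P] [CompleteSpace P]
variable {F : Type*} [NormedAddCommGroup F] [NormedSpace ℝ F]

/-- A function on the surface is of class `C^k` if it is so in a regular parametrization. -/
lemma contMDiffAt_of_comp_param {k : WithTop ℕ∞} (hk0 : k ≠ 0) (hk : k ≤ ∞) {ψ : P → M} {q : P}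
    {f : M → F} (hψ : ContMDiffAt 𝓘(ℝ, P) 𝓘(ℝ, E2) k ψ q)
    (hbij : Function.Bijective (paramDeriv ψ q)) (hf : ContDiffAt ℝ k (f ∘ ψ) q) :
    ContMDiffAt 𝓘(ℝ, E2) 𝓘(ℝ, F) k f (ψ q) := by
  set e := chartAt E2 (ψ q) with he
  have heA : e ∈ atlas E2 M := chart_mem_atlas E2 _
  have hp : ψ q ∈ e.source := mem_chart_source E2 _
  have hem : ContMDiffAt 𝓘(ℝ, E2) 𝓘(ℝ, E2) k e (ψ q) :=
    (contMDiffAt_of_mem_maximalAtlas (IsManifold.subset_maximalAtlas heA) hp).of_le hk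
  have hg : ContDiffAt ℝ k (e ∘ ψ) q := (hem.comp q hψ).contDiffAt
  have hd : ⇑(fderiv ℝ (e ∘ ψ) q) = mfderiv 𝓘(ℝ, E2) 𝓘(ℝ, E2) e (ψ q) ∘ paramDeriv ψ q := by
    have h1 := mfderiv_comp q (hem.mdifferentiableAt hk0) (hψ.mdifferentiableAt hk0)
    rw [mfderiv_eq_fderiv] at h1
    exact funext fun x => DFunLike.congr_fun h1 x
  have hgb : Function.Bijective (fderiv ℝ (e ∘ ψ) q) := by
    rw [hd]
    exact ((mdifferentiable_of_mem_atlas (I := 𝓘(ℝ, E2)) heA).mfderiv_bijective hp).comp hbij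
  set A : P ≃L[ℝ] E2 := ContinuousLinearEquiv.ofBijective (fderiv ℝ (e ∘ ψ) q)
    (LinearMap.ker_eq_bot.2 hgb.1) (LinearMap.range_eq_top.2 hgb.2)
  have hA : HasFDerivAt (e ∘ ψ) (A : P →L[ℝ] E2) q := by
    have h1 : (A : P →L[ℝ] E2) = fderiv ℝ (e ∘ ψ) q := by
      ext x : 1
      rfl
    rw [h1]
    exact (hg.differentiableAt hk0).hasFDerivAt
  set G := hg.localInverse hA hk0
  have hGc : ContDiffAt ℝ k G (e (ψ q)) := hg.to_localInverse hA hk0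
  have hGq : G (e (ψ q)) = q := hg.localInverse_apply_image hA hk0
  have hGr : ∀ᶠ y in 𝓝 (e (ψ q)), (e ∘ ψ) (G y) = y :=
    (hg.hasStrictFDerivAt' hA hk0).eventually_right_inverse
  have hψG : ContinuousAt (ψ ∘ G) (e (ψ q)) := by
    refine ContinuousAt.comp ?_ hGc.continuousAt
    rw [hGq]
    exact hψ.continuousAt
  have hsrc : ∀ᶠ y in 𝓝 (e (ψ q)), ψ (G y) ∈ e.source :=
    hψG.tendsto.eventually (e.open_source.mem_nhds (by simpa [hGq] using hp))
  have h1 : ContDiffAt ℝ k ((f ∘ ψ) ∘ G) (e (ψ q)) :=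
    ContDiffAt.comp _ (by rwa [hGq]) hGc
  refine (ContMDiffAt.comp (ψ q) h1.contMDiffAt hem).congr_of_eventuallyEq ?_
  have hec : Tendsto e (𝓝 (ψ q)) (𝓝 (e (ψ q))) := e.continuousAt hp
  filter_upwards [hec.eventually hGr, hec.eventually hsrc, e.open_source.mem_nhds hp]
    with p' h1 h2 h3
  have h4 : ψ (G (e p')) = p' := e.injOn h2 h3 h1
  simp only [Function.comp_apply, h4]

end InverseFunction

/-! ### The bump is smooth on the surface, and the deformation is an immersion. -/

section Bump

variable {M : Type*} [TopologicalSpace M] [ChartedSpace E2 M]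
variable {α : M → E3} {c : ℝ → M} {L η : ℝ} {φ : ℝ × ℝ → M} {n k : WithTop ℕ∞} {δ : ℝ → ℝ}

/-- The bump `(τ_g(s) v³ / 6) δ(v) N(s)` in the tubular chart. -/
noncomputable def bumpField (α : M → E3) (c : ℝ → M) (δ : ℝ → ℝ) (z : ℝ × ℝ) : E3 :=
  (geodesicTorsion α (c z.1) (velocity c z.1) / 6 * z.2 ^ 3 * δ z.2) • unitNormal α (c z.1)

lemma IsTubularChart.contMDiff_axis (hφ : IsTubularChart k α c L η φ) :
    ContMDiff 𝓘(ℝ, ℝ) 𝓘(ℝ, E2) k c := by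
  rw [show c = φ ∘ fun s => (s, 0) from funext fun s => (hφ.axis s).symm]
  intro s
  exact ContMDiffAt.comp s (hφ.contMDiffAt (z := (s, 0)) hφ.zero_mem)
    (contDiff_id.prodMk contDiff_const).contMDiff.contMDiffAt

lemma IsTubularChart.apply_add_int_mul (hφ : IsTubularChart k α c L η φ) (s : ℝ) {v : ℝ}
    (hv : v ∈ Ioo (-η) η) (m : ℤ) : φ (s + m * L, v) = φ (s, v) :=
  ((hφ.eq_iff s (s + m * L) v hv v hv).2 ⟨rfl, m, rfl⟩).symm

/-- `φ` identifies `(s, v)` only with its translates `(s + mL, v)`, and `c` and its velocity are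
`L`-periodic, so the extension is well defined. -/
lemma IsTubularChart.bump_apply (hφ : IsTubularChart k α c L η φ) (hc : IsMaximalCycle α c L)
    {z : ℝ × ℝ} (hz : z.2 ∈ Ioo (-η) η) : bump α c η φ δ (φ z) = bumpField α c δ z := by
  have hfac : Function.FactorsThrough
      (fun z : {z : ℝ × ℝ // z.2 ∈ Ioo (-η) η} => bumpField α c δ z.1)
      (fun z : {z : ℝ × ℝ // z.2 ∈ Ioo (-η) η} => φ z.1) := by
    rintro ⟨⟨s, v⟩, hv⟩ ⟨⟨s', v'⟩, hv'⟩ h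
    obtain ⟨rfl, m, rfl⟩ := (hφ.eq_iff s s' v hv v' hv').1 h
    have h1 : c (s + m * L) = c s := hc.periodic.int_mul m s
    have h2 : velocity c (s + m * L) = velocity c s := hc.velocity_periodic.int_mul m s
    simp only [bumpField, h1, h2]
  exact hfac.extend_apply (fun _ => 0) ⟨z, hz⟩

/-- The compact set outside of which the bump vanishes. -/
def bumpSupport (φ : ℝ × ℝ → M) (L : ℝ) (δ : ℝ → ℝ) : Set M := φ '' (Icc 0 L ×ˢ tsupport δ)

lemma isCompact_box (hδ_supp : tsupport δ ⊆ Ioo (-η) η) :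
    IsCompact (Icc 0 L ×ˢ tsupport δ) :=
  isCompact_Icc.prod (isCompact_Icc.of_isClosed_subset (isClosed_tsupport δ)
    (hδ_supp.trans Ioo_subset_Icc_self))

lemma IsTubularChart.isCompact_bumpSupport (hφ : IsTubularChart k α c L η φ)
    (hδ_supp : tsupport δ ⊆ Ioo (-η) η) : IsCompact (bumpSupport φ L δ) :=
  (isCompact_box hδ_supp).image_of_continuousOn
    (hφ.contMDiffOn.continuousOn.mono (prod_mono (subset_univ _) hδ_supp))

lemma IsTubularChart.bump_eq_zero (hφ : IsTubularChart k α c L η φ) (hc : IsMaximalCycle α c L)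
    {p : M} (hp : p ∉ bumpSupport φ L δ) : bump α c η φ δ p = 0 := by
  by_cases hex : ∃ z : {z : ℝ × ℝ // z.2 ∈ Ioo (-η) η}, φ z.1 = p
  · obtain ⟨⟨⟨s, v⟩, hv⟩, rfl⟩ := hex
    rw [hφ.bump_apply hc hv, bumpField]
    suffices δ v = 0 by simp [this]
    by_contra hδv
    -- The support uses one period in `s`, so `s` is first translated into `[0, L)`.
    obtain ⟨m, hm, -⟩ := existsUnique_add_zsmul_mem_Ico hc.length_pos s 0
    rw [zero_add, zsmul_eq_mul] at hm
    refine hp ⟨(s + m * L, v), ⟨⟨hm.1, hm.2.le⟩, subset_tsupport δ hδv⟩, ?_⟩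
    exact hφ.apply_add_int_mul s hv m
  · exact Function.extend_apply' _ _ _ hex

lemma IsTubularChart.deformation_apply (hφ : IsTubularChart k α c L η φ)
    (hc : IsMaximalCycle α c L) (ε : ℝ) {z : ℝ × ℝ} (hz : z.2 ∈ Ioo (-η) η) :
    deformation α c η φ δ ε (φ z) = (α ∘ φ) z + ε • bumpField α c δ z := by
  rw [deformation, hφ.bump_apply hc hz]
  rfl

lemma IsTubularChart.deformation_comp_eventuallyEq (hφ : IsTubularChart k α c L η φ)
    (hc : IsMaximalCycle α c L) (ε : ℝ) {z : ℝ × ℝ} (hz : z.2 ∈ Ioo (-η) η) :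
    deformation α c η φ δ ε ∘ φ =ᶠ[𝓝 z] fun z => (α ∘ φ) z + ε • bumpField α c δ z := by
  filter_upwards [(isOpen_univ.prod isOpen_Ioo).mem_nhds
    (show z ∈ univ ×ˢ Ioo (-η) η from ⟨mem_univ _, hz⟩)] with z' hz'
  exact hφ.deformation_apply hc ε hz'.2

lemma injective_of_cross_ne_zero {B : ℝ × ℝ →L[ℝ] E3} (hB : cross (B (1, 0)) (B (0, 1)) ≠ 0) :
    Function.Injective B := by
  rw [injective_iff_map_eq_zero]
  rintro ⟨x, y⟩ h
  have h1 : B (x, y) = x • B (1, 0) + y • B (0, 1) := by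
    rw [← map_smul, ← map_smul, ← map_add]
    simp
  rw [h1] at h
  have h2 := cross_linearComb (B (1, 0)) (B (0, 1)) 1 0 x y
  have h3 := cross_linearComb (B (1, 0)) (B (0, 1)) x y 0 1
  have h4 : ∀ w : E3, cross w 0 = 0 := fun w => by apply E3_ext <;> simp
  have h5 : ∀ w : E3, cross 0 w = 0 := fun w => by apply E3_ext <;> simp
  rw [h, h4] at h2
  rw [h, h5] at h3
  have hy : y = 0 := by simpa [hB] using h2.symm
  have hx : x = 0 := by simpa [hB] using h3.symm
  rw [hx, hy]
  rfl

variable [IsManifold 𝓘(ℝ, E2) ∞ M]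

lemma IsTubularChart.contDiff_normal (hM : IsOrientedAtlas M) (hα : IsImmersionOfClass n α)
    (hk : k + 1 ≤ n) (hn : n ≤ ∞) (hφ : IsTubularChart k α c L η φ) :
    ContDiff ℝ k fun s => unitNormal α (c s) :=
  contDiff_iff_contDiffAt.2 fun s =>
    hα.contDiffAt_unitNormal_comp hM hk hn (hφ.contMDiff_axis s)

/-- The geodesic torsion of the cycle is an algebraic function of the curvatures along it. -/
lemma IsMaximalCycle.contDiff_torsion (hM : IsOrientedAtlas M) (hα : IsImmersionOfClass n α)
    (hk : k + 2 ≤ n) (hn : n ≤ ∞) (hc : IsMaximalCycle α c L) (hφ : IsTubularChart k α c L η φ) :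
    ContDiff ℝ k fun s => geodesicTorsion α (c s) (velocity c s) := by
  -- This formula does not contain the velocity. The velocity of a `C^k` curve is only of class
  -- `C^(k-1)` in general, and would cost the deformation one derivative.
  have h : ∀ s, geodesicTorsion α (c s) (velocity c s) =
      √(√(gaussCurvature α (c s)) * meanTrace α (c s) - 2 * gaussCurvature α (c s)) := by
    intro s
    obtain ⟨y, hy⟩ := exists_diffAt_eq_cross α (c s) (velocity c s)
    exact (hα.forms_of_isMaximalDirection hM ((self_le_add_left 2 k).trans hk) hn
      (hc.unit_speed s) (hc.direction s) hy).2.2.2.2.2.2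
  rw [contDiff_iff_contDiffAt]
  intro s
  have hcs := hφ.contMDiff_axis s
  have hK : ContDiffAt ℝ k (gaussCurvature α ∘ c) s := by
    rw [← contMDiffAt_iff_contDiffAt]
    exact ((hα.contMDiffAt_curvatures hM hk hn (c s)).1).comp s hcs
  have hH : ContDiffAt ℝ k (meanTrace α ∘ c) s := by
    rw [← contMDiffAt_iff_contDiffAt]
    exact ((hα.contMDiffAt_curvatures hM hk hn (c s)).2).comp s hcs
  have hpos : 0 < √(√(gaussCurvature α (c s)) * meanTrace α (c s) - 2 * gaussCurvature α (c s)) := by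
    rw [← h]
    exact (hc.direction s).2.2.2
  rw [funext h]
  refine ContDiffAt.sqrt (((hK.sqrt (hc.direction s).2.1.ne').mul hH).sub
    (contDiffAt_const.mul hK)) ?_
  exact (Real.sqrt_pos.1 hpos).ne'

lemma IsMaximalCycle.contDiff_bumpField (hM : IsOrientedAtlas M) (hα : IsImmersionOfClass n α)
    (hk : k + 2 ≤ n) (hn : n ≤ ∞) (hc : IsMaximalCycle α c L) (hφ : IsTubularChart k α c L η φ)
    (hδ : ContDiff ℝ ∞ δ) : ContDiff ℝ k (bumpField α c δ) := by
  have hk1 : k + 1 ≤ n := (add_le_add_right one_le_two k).trans hk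
  have hk0 : k ≤ n := (self_le_add_right k 2).trans hk
  have h1 := hc.contDiff_torsion hM hα hk hn hφ
  have h2 := hφ.contDiff_normal hM hα hk1 hn
  have h3 : ContDiff ℝ k δ := hδ.of_le (hk0.trans hn)
  exact ((((h1.comp contDiff_fst).div_const 6).mul (contDiff_snd.pow 3)).mul
    (h3.comp contDiff_snd)).smul (h2.comp contDiff_fst)

/-- On the support one tests in the tubular chart, a local diffeomorphism. Off it the bump is
locally zero, because a compact subset of a Hausdorff space is closed. -/
lemma IsMaximalCycle.contMDiff_bump [T2Space M] (hM : IsOrientedAtlas M)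
    (hα : IsImmersionOfClass n α)
    (hk : k + 2 ≤ n) (hk0 : k ≠ 0) (hn : n ≤ ∞) (hc : IsMaximalCycle α c L)
    (hφ : IsTubularChart k α c L η φ)
    (hδ : ContDiff ℝ ∞ δ) (hδ_supp : tsupport δ ⊆ Ioo (-η) η) :
    ContMDiff 𝓘(ℝ, E2) 𝓘(ℝ, E3) k (bump α c η φ δ) := by
  intro p
  by_cases hp : p ∈ bumpSupport φ L δ
  · obtain ⟨z, hz, rfl⟩ := hp
    have hz2 : z.2 ∈ Ioo (-η) η := hδ_supp hz.2
    refine contMDiffAt_of_comp_param hk0 (((self_le_add_right k 2).trans hk).trans hn)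
      (hφ.contMDiffAt hz2) (hφ.bijective_paramDeriv hz2) ?_
    refine (hc.contDiff_bumpField hM hα hk hn hφ hδ).contDiffAt.congr_of_eventuallyEq ?_
    filter_upwards [(isOpen_univ.prod isOpen_Ioo).mem_nhds
      (show z ∈ univ ×ˢ Ioo (-η) η from ⟨mem_univ _, hz2⟩)] with z' hz'
    exact hφ.bump_apply hc hz'.2
  · refine (contMDiffAt_const (c := (0 : E3))).congr_of_eventuallyEq ?_
    filter_upwards [(hφ.isCompact_bumpSupport hδ_supp).isClosed.isOpen_compl.mem_nhds hp]
      with p' hp'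
    exact hφ.bump_eq_zero hc hp'

/-- The deformation is an immersion for small values of the parameter. -/
lemma IsMaximalCycle.eventually_isImmersionOfClass [T2Space M] (hM : IsOrientedAtlas M)
    (hα : IsImmersionOfClass n α)
    (hk : k + 2 ≤ n) (hk1 : 1 ≤ k) (hn : n ≤ ∞) (hc : IsMaximalCycle α c L)
    (hφ : IsTubularChart k α c L η φ)
    (hδ : ContDiff ℝ ∞ δ) (hδ_supp : tsupport δ ⊆ Ioo (-η) η) :
    ∀ᶠ ε in 𝓝 (0 : ℝ), IsImmersionOfClass k (deformation α c η φ δ ε) := by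
  have hk0 : k ≠ 0 := fun h => by simp [h] at hk1
  have hkn : k ≤ n := (self_le_add_right k 2).trans hk
  have hsmooth : ∀ ε, ContMDiff 𝓘(ℝ, E2) 𝓘(ℝ, E3) k (deformation α c η φ δ ε) := fun ε =>
    (hα.contMDiff.of_le hkn).add
      ((contDiff_const_smul ε).contMDiff.comp
        (hc.contMDiff_bump hM hα hk hk0 hn hφ hδ hδ_supp))
  have hh := hc.contDiff_bumpField hM hα hk hn hφ hδ
  have ha : ∀ z : ℝ × ℝ, z.2 ∈ Ioo (-η) η → ContDiffAt ℝ k (α ∘ φ) z := fun z hz =>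
    hα.contDiffAt_comp hkn (hφ.contMDiffAt hz)
  -- Nonvanishing of the normal is an open condition on `(ε, z)`, true at `ε = 0`; compactness of
  -- the box makes it uniform in `z`.
  have hcross : ∀ᶠ ε in 𝓝 (0 : ℝ), ∀ z ∈ Icc 0 L ×ˢ tsupport δ,
      cross (fderiv ℝ (α ∘ φ) z (1, 0) + ε • fderiv ℝ (bumpField α c δ) z (1, 0))
        (fderiv ℝ (α ∘ φ) z (0, 1) + ε • fderiv ℝ (bumpField α c δ) z (0, 1)) ≠ 0 := by
    refine (isCompact_box hδ_supp).eventually_forall_of_forall_eventually (fun z hz => ?_)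
    have hz2 := hδ_supp hz.2
    have h1 : ContinuousAt (fderiv ℝ (α ∘ φ)) z :=
      ((ha z hz2).fderiv_right (m := 0) (by simpa using hk1)).continuousAt
    have h2 : ContinuousAt (fderiv ℝ (bumpField α c δ)) z :=
      (hh.contDiffAt.fderiv_right (m := 0) (by simpa using hk1)).continuousAt
    have h3 : ∀ x : ℝ × ℝ, ContinuousAt (fun w : ℝ × (ℝ × ℝ) =>
        fderiv ℝ (α ∘ φ) w.2 x + w.1 • fderiv ℝ (bumpField α c δ) w.2 x) (0, z) := by
      intro x
      have h4 : ContinuousAt (fun w : ℝ × (ℝ × ℝ) => fderiv ℝ (α ∘ φ) w.2) (0, z) :=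
        ContinuousAt.comp (x := ((0, z) : ℝ × (ℝ × ℝ))) (f := Prod.snd)
          (g := fderiv ℝ (α ∘ φ)) h1 continuousAt_snd
      have h5 : ContinuousAt (fun w : ℝ × (ℝ × ℝ) => fderiv ℝ (bumpField α c δ) w.2) (0, z) :=
        ContinuousAt.comp (x := ((0, z) : ℝ × (ℝ × ℝ))) (f := Prod.snd)
          (g := fderiv ℝ (bumpField α c δ)) h2 continuousAt_snd
      exact (h4.clm_apply continuousAt_const).add
        (continuousAt_fst.smul (h5.clm_apply continuousAt_const))
    refine (continuousAt_cross (h3 (1, 0)) (h3 (0, 1))).eventually_ne ?_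
    simp only [zero_smul, add_zero]
    have h6 := (hα.injective_diffAt (φ z)).comp (hφ.injective_paramDeriv hz2)
    rw [show diffAt α (φ z) ∘ paramDeriv φ z = fderiv ℝ (α ∘ φ) z from
      funext fun x => hα.diffAt_paramDeriv (hk1.trans hkn) ((hφ.contMDiffAt hz2).of_le hk1) x] at h6
    refine cross_ne_zero fun a b hab => ?_
    have h7 : (a, b) = ((0, 0) : ℝ × ℝ) := h6 (by
      rw [show ((0, 0) : ℝ × ℝ) = 0 from rfl, map_zero, ← hab, ← map_smul, ← map_smul, ← map_add]
      simp)
    simpa using h7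
  filter_upwards [hcross] with ε hε
  refine ⟨hsmooth ε, fun p => ?_⟩
  by_cases hp : p ∈ bumpSupport φ L δ
  · obtain ⟨z, hz, rfl⟩ := hp
    have hz2 : z.2 ∈ Ioo (-η) η := hδ_supp hz.2
    have h1 : fderiv ℝ (deformation α c η φ δ ε ∘ φ) z =
        fderiv ℝ (α ∘ φ) z + ε • fderiv ℝ (bumpField α c δ) z := by
      rw [(hφ.deformation_comp_eventuallyEq hc ε hz2).fderiv_eq]
      exact ((((ha z hz2).differentiableAt hk0).hasFDerivAt).add
        ((hh.differentiable hk0 z).hasFDerivAt.const_smul ε)).fderiv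
    have h2 : Function.Injective (fderiv ℝ (deformation α c η φ δ ε ∘ φ) z) := by
      rw [h1]
      exact injective_of_cross_ne_zero (by simpa using hε z hz)
    have h3 : ⇑(fderiv ℝ (deformation α c η φ δ ε ∘ φ) z) =
        diffAt (deformation α c η φ δ ε) (φ z) ∘ paramDeriv φ z :=
      funext fun x => (diffAt_paramDeriv ((hsmooth ε _).mdifferentiableAt hk0)
        ((hφ.contMDiffAt hz2).mdifferentiableAt hk0) x).symm
    rw [h3] at h2
    exact (h2.of_comp_right (hφ.bijective_paramDeriv hz2).2 :
      Function.Injective (diffAt (deformation α c η φ δ ε) (φ z)))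
  · have h1 : deformation α c η φ δ ε =ᶠ[𝓝 p] α := by
      filter_upwards [(hφ.isCompact_bumpSupport hδ_supp).isClosed.isOpen_compl.mem_nhds hp]
        with p' hp'
      rw [deformation, hφ.bump_eq_zero hc hp', smul_zero, add_zero]
    rw [h1.mfderiv_eq]
    exact hα.injective p

end Bump

/-! ### The slope field of the maximal foliation in a parametrization. -/

section Slope

variable {M : Type*} [TopologicalSpace M] [ChartedSpace E2 M]
variable {β : M → E3} {φ : ℝ × ℝ → M} {n k : WithTop ℕ∞}

/-- The first fundamental form in a parametrization. -/
noncomputable def firstCoeff (β : M → E3) (φ : ℝ × ℝ → M) (x y z : ℝ × ℝ) : ℝ :=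
  inner ℝ (fderiv ℝ (β ∘ φ) z x) (fderiv ℝ (β ∘ φ) z y)

/-- The second fundamental form in a parametrization. -/
noncomputable def secondCoeff (β : M → E3) (φ : ℝ × ℝ → M) (x y z : ℝ × ℝ) : ℝ :=
  inner ℝ (unitNormal β (φ z)) (fderiv ℝ (fderiv ℝ (β ∘ φ)) z x y)

/-- The Gaussian curvature in a parametrization. -/
noncomputable def gaussCoeff (β : M → E3) (φ : ℝ × ℝ → M) (z : ℝ × ℝ) : ℝ :=
  (secondCoeff β φ (1, 0) (1, 0) z * secondCoeff β φ (0, 1) (0, 1) z -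
    secondCoeff β φ (1, 0) (0, 1) z ^ 2) /
  (firstCoeff β φ (1, 0) (1, 0) z * firstCoeff β φ (0, 1) (0, 1) z -
    firstCoeff β φ (1, 0) (0, 1) z ^ 2)

/-- The slope `dv / ds` of the maximal geometric mean curvature lines in a parametrization. -/
noncomputable def slope (β : M → E3) (φ : ℝ × ℝ → M) (z : ℝ × ℝ) : ℝ :=
  slopeRoot (secondCoeff β φ (1, 0) (1, 0) z) (secondCoeff β φ (1, 0) (0, 1) z)
    (secondCoeff β φ (0, 1) (0, 1) z) (firstCoeff β φ (1, 0) (1, 0) z)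
    (firstCoeff β φ (1, 0) (0, 1) z) (firstCoeff β φ (0, 1) (0, 1) z)

/-- The numerator of the geodesic torsion in the direction of `(1, slope)`. -/
noncomputable def torsionCoeff (β : M → E3) (φ : ℝ × ℝ → M) (z : ℝ × ℝ) : ℝ :=
  -inner ℝ (fderiv ℝ (unitNormal β ∘ φ) z (1, slope β φ z))
    (cross (unitNormal β (φ z)) (fderiv ℝ (β ∘ φ) z (1, slope β φ z)))

lemma IsImmersionOfClass.contDiffAt_firstCoeff (h : IsImmersionOfClass n β) (hk : k + 1 ≤ n)
    {z : ℝ × ℝ} (hφ : ContMDiffAt 𝓘(ℝ, ℝ × ℝ) 𝓘(ℝ, E2) (k + 1) φ z) (x y : ℝ × ℝ) :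
    ContDiffAt ℝ k (firstCoeff β φ x y) z := by
  have hb := (h.contDiffAt_comp hk hφ).fderiv_right (m := k) le_rfl
  exact (hb.clm_apply contDiffAt_const).inner ℝ (hb.clm_apply contDiffAt_const)

variable [IsManifold 𝓘(ℝ, E2) ∞ M]

lemma IsImmersionOfClass.contDiffAt_secondCoeff (hM : IsOrientedAtlas M)
    (h : IsImmersionOfClass n β) (hk : k + 1 + 1 ≤ n) (hn : n ≤ ∞)
    {z : ℝ × ℝ} (hφ : ContMDiffAt 𝓘(ℝ, ℝ × ℝ) 𝓘(ℝ, E2) (k + 1 + 1) φ z) (x y : ℝ × ℝ) :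
    ContDiffAt ℝ k (secondCoeff β φ x y) z := by
  have hb := ((h.contDiffAt_comp hk hφ).fderiv_right (m := k + 1) le_rfl).fderiv_right
    (m := k) le_rfl
  have hN := h.contDiffAt_unitNormal_comp hM hk hn (hφ.of_le (self_le_add_right _ _))
  exact (hN.of_le (self_le_add_right _ _)).inner ℝ
    ((hb.clm_apply contDiffAt_const).clm_apply contDiffAt_const)

/-- The slope is that of a maximal direction wherever some inequalities hold. -/
lemma IsImmersionOfClass.isMaximalDirection_slope (hM : IsOrientedAtlas M)
    (h : IsImmersionOfClass n β) (hn : 2 ≤ n) (hn' : n ≤ ∞) {z : ℝ × ℝ}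
    (hφ : ContMDiffAt 𝓘(ℝ, ℝ × ℝ) 𝓘(ℝ, E2) 2 φ z)
    (hinj : Function.Injective (paramDeriv φ z)) (hK : 0 < gaussCoeff β φ z)
    (hb : 0 < secondCoeff β φ (1, 0) (0, 1) z -
      √(gaussCoeff β φ z) * firstCoeff β φ (1, 0) (0, 1) z)
    (hd : 0 ≤ (secondCoeff β φ (1, 0) (0, 1) z -
        √(gaussCoeff β φ z) * firstCoeff β φ (1, 0) (0, 1) z) ^ 2 -
      (secondCoeff β φ (0, 1) (0, 1) z - √(gaussCoeff β φ z) * firstCoeff β φ (0, 1) (0, 1) z) *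
      (secondCoeff β φ (1, 0) (1, 0) z - √(gaussCoeff β φ z) * firstCoeff β φ (1, 0) (1, 0) z))
    (ht : 0 < torsionCoeff β φ z) :
    IsMaximalDirection β (φ z) (paramDeriv φ z (1, slope β φ z)) := by
  have hφ1 := hφ.of_le one_le_two
  have hn1 : 1 ≤ n := one_le_two.trans hn
  have hI : ∀ x y, firstForm β (φ z) (paramDeriv φ z x) (paramDeriv φ z y) = firstCoeff β φ x y z :=
    fun x y => h.firstForm_paramDeriv hn1 hφ1 x y
  have hII : ∀ x y, secondForm β (φ z) (paramDeriv φ z x) (paramDeriv φ z y) =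
      secondCoeff β φ x y z := fun x y => h.secondForm_paramDeriv hM hn hn' hφ x y
  have hind : ∀ a b : ℝ, a • paramDeriv φ z (1, 0) + b • paramDeriv φ z (0, 1) = 0 →
      a = 0 ∧ b = 0 := by
    intro a b hab
    have h7 : (a, b) = ((0, 0) : ℝ × ℝ) := hinj (by
      rw [show ((0, 0) : ℝ × ℝ) = 0 from rfl, map_zero, ← hab, ← map_smul, ← map_smul, ← map_add]
      simp)
    simpa using h7
  have hKz : gaussCurvature β (φ z) = gaussCoeff β φ z := by
    rw [(h.curvatures_eq hM hn hn' (φ z) hind).1]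
    simp only [hI, hII]
    rfl
  set p := slope β φ z with hp
  have hx : paramDeriv φ z (1, p) = (1 : ℝ) • paramDeriv φ z (1, 0) + p • paramDeriv φ z (0, 1) := by
    rw [← map_smul, ← map_smul, ← map_add]
    simp
  have hx0 : paramDeriv φ z (1, p) ≠ 0 := by
    intro h0
    exact one_ne_zero (hind 1 p (hx ▸ h0)).1
  have hIpos : 0 < firstForm β (φ z) (paramDeriv φ z (1, p)) (paramDeriv φ z (1, p)) := by
    rw [firstForm]
    refine real_inner_self_pos.2 fun h0 => hx0 (h.injective_diffAt (φ z) ?_)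
    rw [h0, map_zero]
  refine ⟨hx0, hKz ▸ hK, ?_, ?_⟩
  · rw [normalCurvature, div_eq_iff hIpos.ne', hx, secondForm_comb, firstForm_comb, hKz,
      h.secondForm_symm hM hn hn' _ (paramDeriv φ z (0, 1)) (paramDeriv φ z (1, 0)),
      firstForm_symm _ _ (paramDeriv φ z (0, 1)) (paramDeriv φ z (1, 0))]
    simp only [hI, hII]
    have := slopeRoot_spec hb hd
    rw [show slopeRoot _ _ _ _ _ _ = p from rfl] at this
    rw [show gaussCoeff β φ z = _ / _ from rfl]
    linear_combination this
  · rw [geodesicTorsion]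
    refine div_pos ?_ hIpos
    rw [h.diffAt_unitNormal_paramDeriv hM hn hn' hφ1, h.diffAt_paramDeriv hn1 hφ1]
    exact ht

/-- A maximal cycle with tangent `φ_s` and with `φ_v` in the direction of `N ∧ T`: the values of the
fundamental forms. -/
lemma IsImmersionOfClass.coeffs_axis (hM : IsOrientedAtlas M)
    (h : IsImmersionOfClass n β) (hn : 2 ≤ n) (hn' : n ≤ ∞) {z : ℝ × ℝ}
    (hφ : ContMDiffAt 𝓘(ℝ, ℝ × ℝ) 𝓘(ℝ, E2) 2 φ z)
    (hx : ‖diffAt β (φ z) (paramDeriv φ z (1, 0))‖ = 1)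
    (hmax : IsMaximalDirection β (φ z) (paramDeriv φ z (1, 0)))
    (hy : diffAt β (φ z) (paramDeriv φ z (0, 1)) =
      cross (unitNormal β (φ z)) (diffAt β (φ z) (paramDeriv φ z (1, 0)))) :
    firstCoeff β φ (1, 0) (1, 0) z = 1 ∧ firstCoeff β φ (1, 0) (0, 1) z = 0 ∧
      firstCoeff β φ (0, 1) (0, 1) z = 1 ∧
      secondCoeff β φ (1, 0) (0, 1) z = geodesicTorsion β (φ z) (paramDeriv φ z (1, 0)) ∧
      0 < secondCoeff β φ (1, 0) (0, 1) z ∧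
      0 < secondCoeff β φ (1, 0) (1, 0) z * secondCoeff β φ (0, 1) (0, 1) z -
        secondCoeff β φ (1, 0) (0, 1) z ^ 2 ∧
      secondCoeff β φ (1, 0) (1, 0) z = √(secondCoeff β φ (1, 0) (1, 0) z *
        secondCoeff β φ (0, 1) (0, 1) z - secondCoeff β φ (1, 0) (0, 1) z ^ 2) ∧
      slope β φ z = 0 ∧ torsionCoeff β φ z = secondCoeff β φ (1, 0) (0, 1) z := by
  have hφ1 := hφ.of_le one_le_two
  have hn1 : 1 ≤ n := one_le_two.trans hn
  have hI : ∀ x y, firstForm β (φ z) (paramDeriv φ z x) (paramDeriv φ z y) = firstCoeff β φ x y z :=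
    fun x y => h.firstForm_paramDeriv hn1 hφ1 x y
  have hII : ∀ x y, secondForm β (φ z) (paramDeriv φ z x) (paramDeriv φ z y) =
      secondCoeff β φ x y z := fun x y => h.secondForm_paramDeriv hM hn hn' hφ x y
  obtain ⟨h1, h2, h3, h4, h5, h6, -⟩ := h.forms_of_isMaximalDirection hM hn hn' hx hmax hy
  have hK := hmax.2.1
  have hτ := hmax.2.2.2
  rw [h6] at h4 hK
  rw [← h5] at hτ
  simp only [hI, hII] at h1 h2 h3 h4 h5 h6 hK hτ
  have hsl : slope β φ z = 0 := by
    rw [slope, h1, h2, h3]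
    exact slopeRoot_of_principal h4
  refine ⟨h1, h2, h3, h5, hτ, hK, h4, hsl, ?_⟩
  rw [torsionCoeff, hsl, ← h.diffAt_unitNormal_paramDeriv hM hn hn' hφ1,
    ← h.diffAt_paramDeriv hn1 hφ1, ← hy, ← hII]
  rfl

/-- On the axis the quantities required to be positive are `K`, `f = τ_g`, the discriminant `τ_g²`
and the torsion `τ_g`; they are continuous, so positivity persists nearby. Class `C^3` makes the
second form, and with it the slope, of class `C^1`. -/
lemma IsImmersionOfClass.eventually_isMaximalDirection_slope (hM : IsOrientedAtlas M)
    (h : IsImmersionOfClass n β) (hn : 3 ≤ n) (hn' : n ≤ ∞) {z : ℝ × ℝ}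
    (hφ : ContMDiffAt 𝓘(ℝ, ℝ × ℝ) 𝓘(ℝ, E2) 3 φ z)
    (hinj : ∀ᶠ z' in 𝓝 z, Function.Injective (paramDeriv φ z'))
    (hx : ‖diffAt β (φ z) (paramDeriv φ z (1, 0))‖ = 1)
    (hmax : IsMaximalDirection β (φ z) (paramDeriv φ z (1, 0)))
    (hy : diffAt β (φ z) (paramDeriv φ z (0, 1)) =
      cross (unitNormal β (φ z)) (diffAt β (φ z) (paramDeriv φ z (1, 0)))) :
    ContDiffAt ℝ 1 (slope β φ) z ∧
      ∀ᶠ z' in 𝓝 z, IsMaximalDirection β (φ z') (paramDeriv φ z' (1, slope β φ z')) := by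
  have h23 : (2 : WithTop ℕ∞) ≤ 3 := by exact_mod_cast (show 2 ≤ 3 by norm_num)
  have h13 : (1 : WithTop ℕ∞) + 1 + 1 = 3 := by norm_num
  have hφ2 := hφ.of_le h23
  have hn2 : 2 ≤ n := h23.trans hn
  obtain ⟨h1, h2, h3, h4, hτ, hK, he, hsl, ht⟩ := h.coeffs_axis hM hn2 hn' hφ2 hx hmax hy
  have hI : ∀ x y, ContDiffAt ℝ 1 (firstCoeff β φ x y) z := fun x y =>
    h.contDiffAt_firstCoeff (by rwa [one_add_one_eq_two]) (by rwa [one_add_one_eq_two]) x y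
  have hII : ∀ x y, ContDiffAt ℝ 1 (secondCoeff β φ x y) z := fun x y =>
    h.contDiffAt_secondCoeff hM (by rwa [h13]) hn' (by rwa [h13]) x y
  have hs : ContDiffAt ℝ 1 (slope β φ) z :=
    contDiffAt_slopeRoot (hII _ _) (hII _ _) (hII _ _) (hI _ _) (hI _ _) (hI _ _) h1 h2 h3 hK he hτ
  refine ⟨hs, ?_⟩
  have hgv : gaussCoeff β φ z = secondCoeff β φ (1, 0) (1, 0) z * secondCoeff β φ (0, 1) (0, 1) z -
        secondCoeff β φ (1, 0) (0, 1) z ^ 2 := by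
    rw [gaussCoeff, h1, h2, h3]
    norm_num
  have hgc : ContinuousAt (gaussCoeff β φ) z := by
    refine ContinuousAt.div ((((hII _ _).continuousAt).mul (hII _ _).continuousAt).sub
      ((hII _ _).continuousAt.pow 2)) ((((hI _ _).continuousAt).mul (hI _ _).continuousAt).sub
      ((hI _ _).continuousAt.pow 2)) ?_
    rw [h1, h2, h3]
    norm_num
  have hkc : ContinuousAt (fun z => √(gaussCoeff β φ z)) z := hgc.sqrt
  have hbc := (hII (1, 0) (0, 1)).continuousAt.sub (hkc.mul (hI (1, 0) (0, 1)).continuousAt)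
  have hdc := (hbc.pow 2).sub
    (((hII (0, 1) (0, 1)).continuousAt.sub (hkc.mul (hI (0, 1) (0, 1)).continuousAt)).mul
      ((hII (1, 0) (1, 0)).continuousAt.sub (hkc.mul (hI (1, 0) (1, 0)).continuousAt)))
  have htc : ContinuousAt (torsionCoeff β φ) z := by
    have hN : ContDiffAt ℝ 2 (unitNormal β ∘ φ) z := h.contDiffAt_unitNormal_comp hM
      (by rwa [show (2 : WithTop ℕ∞) + 1 = 3 by norm_num]) hn' hφ2
    have hb : ContDiffAt ℝ 2 (β ∘ φ) z := h.contDiffAt_comp hn2 hφ2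
    have hv : ContinuousAt (fun z => ((1 : ℝ), slope β φ z)) z :=
      continuousAt_const.prodMk hs.continuousAt
    have h1N := (hN.fderiv_right (m := 0) (by simp)).continuousAt.clm_apply hv
    have h1b := (hb.fderiv_right (m := 0) (by simp)).continuousAt.clm_apply hv
    exact (h1N.inner (𝕜 := ℝ) (continuousAt_cross hN.continuousAt h1b)).neg
  have : IsManifold 𝓘(ℝ, E2) 2 M := IsManifold.of_le (n := ∞) (WithTop.coe_le_coe.2 le_top)
  have hk : √(gaussCoeff β φ z) = secondCoeff β φ (1, 0) (1, 0) z := by rw [hgv, ← he]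
  filter_upwards [hinj, (contMDiffAt_iff_contMDiffAt_nhds (WithTop.coe_injective.ne (ENat.natCast_ne_top 2))).1 hφ2,
    hgc.eventually (lt_mem_nhds (by rw [hgv]; exact hK : 0 < gaussCoeff β φ z)),
    hbc.eventually (lt_mem_nhds (a := 0) (by simpa [h2] using hτ)),
    hdc.eventually (lt_mem_nhds (a := 0) (by simpa [h1, h2, hk] using pow_pos hτ 2)),
    htc.eventually (lt_mem_nhds (by rw [ht]; exact hτ : 0 < torsionCoeff β φ z))]
    with z' g1 g2 g3 g4 g5 g6
  exact h.isMaximalDirection_slope hM hn2 hn' g2 g1 g3 g4 (le_of_lt g5) g6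

end Slope

/-! ### Derivatives of `v³ u(s)`. -/

section Cubic

variable {V : Type*} [NormedAddCommGroup V] [NormedSpace ℝ V]

lemma hasFDerivAt_separated {p : ℝ → ℝ} {w : ℝ → V} {p' : ℝ} {w' : V} {z : ℝ × ℝ}
    (hp : HasDerivAt p p' z.2) (hw : HasDerivAt w w' z.1) :
    HasFDerivAt (fun z : ℝ × ℝ => p z.2 • w z.1)
      (p z.2 • (ContinuousLinearMap.fst ℝ ℝ ℝ).smulRight w' +
        (p' • ContinuousLinearMap.snd ℝ ℝ ℝ).smulRight (w z.1)) z := by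
  have h1 : HasFDerivAt (fun z : ℝ × ℝ => p z.2) (p' • ContinuousLinearMap.snd ℝ ℝ ℝ) z :=
    hp.comp_hasFDerivAt z hasFDerivAt_snd
  have h2 : HasFDerivAt (fun z : ℝ × ℝ => w z.1) ((ContinuousLinearMap.fst ℝ ℝ ℝ).smulRight w') z := by
    have := hw.hasFDerivAt.comp z (hasFDerivAt_fst (p := z))
    refine this.congr_fderiv ?_
    ext <;> simp
  exact h1.smul h2

/-- The derivatives of `v³ u(s)`. -/
lemma fderiv_cubic {u : ℝ → V} (hu : ContDiff ℝ 2 u) :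
    (∀ z x : ℝ × ℝ, fderiv ℝ (fun z : ℝ × ℝ => z.2 ^ 3 • u z.1) z x =
      (z.2 ^ 3 * x.1) • deriv u z.1 + (3 * z.2 ^ 2 * x.2) • u z.1) ∧
    ∀ z y x : ℝ × ℝ, fderiv ℝ (fderiv ℝ (fun z : ℝ × ℝ => z.2 ^ 3 • u z.1)) z y x =
      (z.2 ^ 3 * y.1 * x.1) • deriv (deriv u) z.1 +
        (3 * z.2 ^ 2 * (y.2 * x.1 + y.1 * x.2)) • deriv u z.1 + (6 * z.2 * y.2 * x.2) • u z.1 := by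
  have hu1 : ∀ s, HasDerivAt u (deriv u s) s := fun s =>
    (hu.differentiable two_ne_zero s).hasDerivAt
  have hu2 : ∀ s, HasDerivAt (deriv u) (deriv (deriv u) s) s := fun s =>
    (((contDiff_succ_iff_deriv (n := 1)).1 (by simpa [one_add_one_eq_two] using hu)).2.2.differentiable
      one_ne_zero s).hasDerivAt
  have hp3 : ∀ v : ℝ, HasDerivAt (fun v : ℝ => v ^ 3) (3 * v ^ 2) v := fun v => by
    simpa using hasDerivAt_pow 3 v
  have hp2 : ∀ v : ℝ, HasDerivAt (fun v : ℝ => 3 * v ^ 2) (6 * v) v := fun v => by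
    refine ((hasDerivAt_pow 2 v).const_mul 3).congr_deriv ?_
    norm_num
    ring
  have h1 : ∀ z x : ℝ × ℝ, fderiv ℝ (fun z : ℝ × ℝ => z.2 ^ 3 • u z.1) z x =
      (z.2 ^ 3 * x.1) • deriv u z.1 + (3 * z.2 ^ 2 * x.2) • u z.1 := by
    intro z x
    rw [(hasFDerivAt_separated (hp3 z.2) (hu1 z.1)).fderiv]
    simp [smul_smul]
  refine ⟨h1, fun z y x => ?_⟩
  have hc3 : ContDiff ℝ 2 (fun z : ℝ × ℝ => z.2 ^ 3 • u z.1) :=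
    (contDiff_snd.pow 3).smul (hu.comp contDiff_fst)
  have h2 : HasFDerivAt (fderiv ℝ (fun z : ℝ × ℝ => z.2 ^ 3 • u z.1))
      (fderiv ℝ (fderiv ℝ (fun z : ℝ × ℝ => z.2 ^ 3 • u z.1)) z) z :=
    ((hc3.fderiv_right (m := 1) (by norm_num)).differentiable one_ne_zero z).hasFDerivAt
  have h3 := h2.clm_apply (hasFDerivAt_const x z)
  have h4 := ((hasFDerivAt_separated (hp3 z.2) (hu2 z.1)).const_smul x.1).add
    ((hasFDerivAt_separated (hp2 z.2) (hu1 z.1)).const_smul x.2)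
  have h5 := DFunLike.congr_fun (h3.unique (h4.congr_of_eventuallyEq
    (Eventually.of_forall fun z => by
      simp only [h1, Pi.add_apply, Pi.smul_apply, smul_smul]
      congr 2 <;> ring))) y
  simp at h5
  rw [h5]
  module

/-- Only `∂_v²(v³) = 6v` is of first order at `v = 0`; the terms that contain a derivative in `s`
are of order `v²` or `v³`. -/
lemma hasDerivAt_snd_fderiv_cubic {u : ℝ → V} (hu : ContDiff ℝ 2 u) (s : ℝ) (y x : ℝ × ℝ) :
    HasDerivAt (fun v => fderiv ℝ (fderiv ℝ (fun z : ℝ × ℝ => z.2 ^ 3 • u z.1)) (s, v) y x)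
      ((6 * (y.2 * x.2)) • u s) 0 := by
  simp only [(fderiv_cubic hu).2]
  have h1 : HasDerivAt (fun v : ℝ => v ^ 3 * y.1 * x.1) 0 0 := by
    simpa using ((hasDerivAt_pow 3 (0 : ℝ)).mul_const y.1).mul_const x.1
  have h2 : HasDerivAt (fun v : ℝ => 3 * v ^ 2 * (y.2 * x.1 + y.1 * x.2)) 0 0 := by
    simpa using ((hasDerivAt_pow 2 (0 : ℝ)).const_mul 3).mul_const (y.2 * x.1 + y.1 * x.2)
  have h3 : HasDerivAt (fun v : ℝ => 6 * v * y.2 * x.2) (6 * (y.2 * x.2)) 0 := by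
    refine ((((hasDerivAt_id (0 : ℝ)).const_mul 6).mul_const y.2).mul_const x.2).congr_deriv ?_
    ring
  refine (((h1.smul_const (deriv (deriv u) s)).add (h2.smul_const (deriv u s))).add
    (h3.smul_const (u s))).congr_deriv ?_
  simp

end Cubic

/-! ### Vectors orthogonal to a frame. -/

section Frame

/-- Here `w ∧ (X ∧ Y) = ⟨w, Y⟩ X - ⟨w, X⟩ Y = 0` and `w ⊥ X ∧ Y`, so Lagrange's identity gives `|w|²
|X ∧ Y|² = 0`. -/
lemma eq_zero_of_inner_frame {N X Y w : E3} (hN : ∃ t : ℝ, N = t • cross X Y) (hN1 : ‖N‖ = 1)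
    (h0 : inner ℝ w N = 0) (hX : inner ℝ w X = 0) (hY : inner ℝ w Y = 0) : w = 0 := by
  obtain ⟨t, rfl⟩ := hN
  have ht : t ≠ 0 := by
    rintro rfl
    simp at hN1
  have hc : cross X Y ≠ 0 := by
    intro hc
    simp [hc] at hN1
  rw [inner_smul_right, mul_eq_zero, or_iff_right ht] at h0
  have h1 : cross w (cross X Y) = inner ℝ w Y • X - inner ℝ w X • Y := by
    apply E3_ext <;> simp only [PiLp.sub_apply, PiLp.smul_apply, smul_eq_mul, inner_eq, cross_zero',
      cross_one', cross_two'] <;> ring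
  rw [hX, hY, zero_smul, zero_smul, sub_zero] at h1
  have h2 := inner_cross_self_cross w (cross X Y)
  rw [h1, h0, inner_zero_left] at h2
  have h3 : inner ℝ w w * inner ℝ (cross X Y) (cross X Y) = 0 := by linarith
  rcases mul_eq_zero.1 h3 with h | h
  · exact inner_self_eq_zero.1 h
  · exact absurd (inner_self_eq_zero.1 h) hc

end Frame

/-! ### The 2-jet of the deformation along the cycle. -/

section Axis

variable {M : Type*} [TopologicalSpace M] [ChartedSpace E2 M]
variable {α : M → E3} {c : ℝ → M} {L η : ℝ} {φ : ℝ × ℝ → M} {n k : WithTop ℕ∞} {δ : ℝ → ℝ}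

/-- In a tubular chart, `φ_v` is in the direction of `N ∧ T` along the cycle. -/
lemma IsTubularChart.diffAt_snd (hα : IsImmersionOfClass n α) (hn : 1 ≤ n) (hk : 1 ≤ k)
    (hφ : IsTubularChart k α c L η φ) (s : ℝ) :
    diffAt α (c s) (paramDeriv φ (s, 0) (0, 1)) = cross (unitNormal α (c s)) (tangent α c s) := by
  have hφs : ContMDiffAt 𝓘(ℝ, ℝ × ℝ) 𝓘(ℝ, E2) 1 φ (s, 0) :=
    (hφ.contMDiffAt (z := (s, 0)) hφ.zero_mem).of_le hk
  set N := unitNormal α (c s) with hN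
  set X := cross N (tangent α c s) with hX
  set Y := diffAt α (c s) (paramDeriv φ (s, 0) (0, 1)) with hY
  have hYN : inner ℝ N Y = 0 := inner_unitNormal_diffAt _ _ _
  have hXN : inner ℝ N X = 0 := by rw [real_inner_comm, hX, inner_cross_left]
  have hYb : Y = fderiv ℝ (α ∘ φ) (s, 0) (0, 1) := by
    rw [hY, ← hφ.axis s, hα.diffAt_paramDeriv hn hφs]
  have h1 : HasDerivAt (fun v : ℝ => (α ∘ φ) (s, v)) Y 0 := by
    rw [hYb]
    exact ((hα.contDiffAt_comp hn hφs).differentiableAt one_ne_zero).hasFDerivAt.comp_hasDerivAt 0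
      ((hasDerivAt_const 0 s).prodMk (hasDerivAt_id 0))
  have h2 := (((h1.sub_const (α (c s))).sub ((hasDerivAt_id (0 : ℝ)).smul_const X)).inner ℝ
    (hasDerivAt_const (0 : ℝ) (Y - X)))
  -- By the normal form `α - c - vX` is a multiple of `N`, and `Y - X` is tangent. Differentiating
  -- the vanishing product gives `|Y - X|² = 0`, without any regularity of the height `W`.
  have h3 : (fun v : ℝ => inner ℝ (((α ∘ φ) (s, v) - α (c s)) - v • X) (Y - X)) =ᶠ[𝓝 0]
      fun _ => 0 := by
    filter_upwards [Ioo_mem_nhds hφ.zero_mem.1 hφ.zero_mem.2] with v hv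
    obtain ⟨w, hw⟩ := hφ.normal_form s v hv
    rw [Function.comp_apply, hw]
    rw [show α (c s) + v • X + w • N - α (c s) - v • X = w • N by abel, inner_smul_left,
      inner_sub_right, hYN, hXN]
    simp
  have h4 := h2.unique ((hasDerivAt_const (0 : ℝ) (0 : ℝ)).congr_of_eventuallyEq h3)
  simp only [inner_zero_right, zero_add, one_smul] at h4
  exact sub_eq_zero.1 (inner_self_eq_zero.1 h4)

/-- The factor `τ_g N / 6` of the bump. -/
noncomputable def bumpFactor (α : M → E3) (c : ℝ → M) (s : ℝ) : E3 :=
  (geodesicTorsion α (c s) (velocity c s) / 6) • unitNormal α (c s)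

lemma bumpField_eventuallyEq (hδ : ∀ᶠ v in 𝓝 (0 : ℝ), δ v = 1) (s : ℝ) :
    bumpField α c δ =ᶠ[𝓝 (s, 0)] fun z => z.2 ^ 3 • bumpFactor α c z.1 := by
  have h1 : Tendsto (Prod.snd : ℝ × ℝ → ℝ) (𝓝 (s, 0)) (𝓝 0) := continuous_snd.tendsto (s, (0 : ℝ))
  filter_upwards [h1.eventually hδ] with z hz
  rw [bumpField, bumpFactor, hz, smul_smul]
  congr 1
  ring

variable [IsManifold 𝓘(ℝ, E2) ∞ M]

/-- The deformation agrees with `α` to second order along the cycle, and its third derivatives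
differ by that of the bump. -/
lemma IsMaximalCycle.fderiv_deformation_axis (hM : IsOrientedAtlas M)
    (hα : IsImmersionOfClass n α)
    (hk : k + 2 ≤ n) (hk3 : 3 ≤ k) (hn : n ≤ ∞) (hc : IsMaximalCycle α c L)
    (hφ : IsTubularChart k α c L η φ) (hδ : ∀ᶠ v in 𝓝 (0 : ℝ), δ v = 1) (ε s : ℝ) :
    fderiv ℝ (deformation α c η φ δ ε ∘ φ) (s, 0) = fderiv ℝ (α ∘ φ) (s, 0) ∧
    fderiv ℝ (fderiv ℝ (deformation α c η φ δ ε ∘ φ)) (s, 0) =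
      fderiv ℝ (fderiv ℝ (α ∘ φ)) (s, 0) ∧
    ∀ x y : ℝ × ℝ, HasDerivAt (fun v => fderiv ℝ (fderiv ℝ (deformation α c η φ δ ε ∘ φ)) (s, v) x y)
      (fderiv ℝ (fderiv ℝ (fderiv ℝ (α ∘ φ))) (s, 0) (0, 1) x y +
        (ε * (geodesicTorsion α (c s) (velocity c s) * (x.2 * y.2))) • unitNormal α (c s)) 0 := by
  have h23 : (2 : WithTop ℕ∞) ≤ 3 := by exact_mod_cast (show 2 ≤ 3 by norm_num)
  have hkn : k ≤ n := (self_le_add_right k 2).trans hk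
  have hk1 : k + 1 ≤ n := (add_le_add_right one_le_two k).trans hk
  have hu : ContDiff ℝ k (bumpFactor α c) :=
    ((hc.contDiff_torsion hM hα hk hn hφ).div_const 6).smul (hφ.contDiff_normal hM hα hk1 hn)
  have hu2 : ContDiff ℝ 2 (bumpFactor α c) := hu.of_le (h23.trans hk3)
  set H : ℝ × ℝ → E3 := fun z => z.2 ^ 3 • bumpFactor α c z.1 with hH
  have hHc : ContDiff ℝ k H := (contDiff_snd.pow 3).smul (hu.comp contDiff_fst)
  have ha : ContDiffAt ℝ k (α ∘ φ) (s, 0) :=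
    hα.contDiffAt_comp hkn (hφ.contMDiffAt (z := (s, 0)) hφ.zero_mem)
  have ha3 : ContDiffAt ℝ 3 (α ∘ φ) (s, 0) := ha.of_le hk3
  have hda : ContDiffAt ℝ 2 (fderiv ℝ (α ∘ φ)) (s, 0) := ha3.fderiv_right (by norm_num)
  have hdda : ContDiffAt ℝ 1 (fderiv ℝ (fderiv ℝ (α ∘ φ))) (s, 0) := hda.fderiv_right (by norm_num)
  have hdH : ContDiff ℝ 2 (fderiv ℝ H) := (hHc.of_le hk3).fderiv_right (by norm_num)
  have e0 : deformation α c η φ δ ε ∘ φ =ᶠ[𝓝 (s, 0)] fun z => (α ∘ φ) z + ε • H z := by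
    filter_upwards [hφ.deformation_comp_eventuallyEq hc ε (z := (s, 0)) hφ.zero_mem,
      bumpField_eventuallyEq (α := α) (c := c) hδ s] with z h1 h2
    rw [h1, h2]
  have e1 : fderiv ℝ (deformation α c η φ δ ε ∘ φ) =ᶠ[𝓝 (s, 0)]
      fun z => fderiv ℝ (α ∘ φ) z + ε • fderiv ℝ H z := by
    refine e0.fderiv.trans ?_
    filter_upwards [ha3.eventually (WithTop.coe_injective.ne (ENat.natCast_ne_top 3))] with z hz
    exact ((hz.differentiableAt three_ne_zero).hasFDerivAt.add
      (((hHc.of_le hk3).differentiable three_ne_zero z).hasFDerivAt.const_smul ε)).fderiv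
  have e2 : fderiv ℝ (fderiv ℝ (deformation α c η φ δ ε ∘ φ)) =ᶠ[𝓝 (s, 0)]
      fun z => fderiv ℝ (fderiv ℝ (α ∘ φ)) z + ε • fderiv ℝ (fderiv ℝ H) z := by
    refine e1.fderiv.trans ?_
    filter_upwards [hda.eventually (WithTop.coe_injective.ne (ENat.natCast_ne_top 2))] with z hz
    exact ((hz.differentiableAt two_ne_zero).hasFDerivAt.add
      ((hdH.differentiable two_ne_zero z).hasFDerivAt.const_smul ε)).fderiv
  obtain ⟨c1, c2⟩ := fderiv_cubic hu2
  have z1 : fderiv ℝ H (s, 0) = 0 := by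
    refine ContinuousLinearMap.ext fun x => ?_
    rw [hH, c1]
    simp
  have z2 : fderiv ℝ (fderiv ℝ H) (s, 0) = 0 := by
    refine ContinuousLinearMap.ext fun x => ContinuousLinearMap.ext fun y => ?_
    rw [hH, c2]
    simp
  refine ⟨by rw [e1.eq_of_nhds, z1]; exact ContinuousLinearMap.ext fun x => by simp,
    by rw [e2.eq_of_nhds, z2]; exact
      ContinuousLinearMap.ext fun x => ContinuousLinearMap.ext fun y => by simp, fun x y => ?_⟩
  have h1 : HasDerivAt (fun v => fderiv ℝ (fderiv ℝ (α ∘ φ)) (s, v) x y)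
      (fderiv ℝ (fderiv ℝ (fderiv ℝ (α ∘ φ))) (s, 0) (0, 1) x y) 0 := by
    have h2 := (hdda.differentiableAt one_ne_zero).hasFDerivAt.comp_hasDerivAt (0 : ℝ)
      ((hasDerivAt_const 0 s).prodMk (hasDerivAt_id 0))
    have h3 := (h2.clm_apply (hasDerivAt_const 0 x)).clm_apply (hasDerivAt_const 0 y)
    simpa using h3
  have h2 := h1.add ((hasDerivAt_snd_fderiv_cubic hu2 s x y).const_smul ε)
  have ht : Tendsto (fun v : ℝ => (s, v)) (𝓝 0) (𝓝 (s, 0)) :=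
    (Continuous.prodMk_right s).tendsto 0
  refine (h2.congr_of_eventuallyEq ?_).congr_deriv ?_
  · filter_upwards [ht.eventually e2] with v hv
    rw [hv]
    rfl
  -- The `6` from the third derivative of `v³` cancels the `1/6` of the bump.
  · rw [bumpFactor, smul_smul, smul_smul]
    congr 2
    ring

/-- Along the cycle, the deformation has the differential, the normal, and the differential of the
normal of `α`. -/
lemma IsMaximalCycle.normal_deformation_axis (hM : IsOrientedAtlas M)
    (hα : IsImmersionOfClass n α)
    (hk : k + 2 ≤ n) (hk3 : 3 ≤ k) (hn : n ≤ ∞) (hc : IsMaximalCycle α c L)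
    (hφ : IsTubularChart k α c L η φ) (hδ : ∀ᶠ v in 𝓝 (0 : ℝ), δ v = 1) {ε : ℝ}
    (hβ : IsImmersionOfClass k (deformation α c η φ δ ε)) (s : ℝ) :
    diffAt (deformation α c η φ δ ε) (c s) = diffAt α (c s) ∧
    unitNormal (deformation α c η φ δ ε) (c s) = unitNormal α (c s) ∧
    fderiv ℝ (unitNormal (deformation α c η φ δ ε) ∘ φ) (s, 0) =
      fderiv ℝ (unitNormal α ∘ φ) (s, 0) ∧
    diffAt (unitNormal (deformation α c η φ δ ε)) (c s) = diffAt (unitNormal α) (c s) := by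
  have h23 : (2 : WithTop ℕ∞) ≤ 3 := by exact_mod_cast (show 2 ≤ 3 by norm_num)
  have hkn : k ≤ n := (self_le_add_right k 2).trans hk
  have hk2 : 2 ≤ k := h23.trans hk3
  have hk1 : 1 ≤ k := one_le_two.trans hk2
  set β := deformation α c η φ δ ε
  obtain ⟨d1, d2, -⟩ := hc.fderiv_deformation_axis hM hα hk hk3 hn hφ hδ ε s
  have hz : ((s, 0) : ℝ × ℝ).2 ∈ Ioo (-η) η := hφ.zero_mem
  have hφk := hφ.contMDiffAt hz
  have hsurj := (hφ.bijective_paramDeriv hz).2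
  have hd : diffAt β (c s) = diffAt α (c s) := by
    rw [← hφ.axis s]
    ext x : 1
    obtain ⟨x, rfl⟩ := hsurj x
    rw [hα.diffAt_paramDeriv (hk1.trans hkn) (hφk.of_le hk1),
      hβ.diffAt_paramDeriv hk1 (hφk.of_le hk1), d1]
  have hN : unitNormal β (c s) = unitNormal α (c s) := by
    rw [unitNormal_eq, hd, unitNormal_eq]
  have hdN : fderiv ℝ (unitNormal β ∘ φ) (s, 0) = fderiv ℝ (unitNormal α ∘ φ) (s, 0) := by
    -- The derivative of a unit normal has no normal component. Its tangential components are `-⟨N,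
    -- β_xy⟩`, determined by the common 2-jet (`hxy`), so the two derivatives coincide.
    have key : ∀ (γ : M → E3) (m : WithTop ℕ∞), IsImmersionOfClass m γ → 2 ≤ m → m ≤ ∞ → ∀ x,
        inner ℝ (fderiv ℝ (unitNormal γ ∘ φ) (s, 0) x) (unitNormal γ (c s)) = 0 := by
      intro γ m hγ hm hm' x
      have h1 := (hγ.contDiffAt_unitNormal_comp hM (k := 1) (by rwa [one_add_one_eq_two]) hm'
        (hφk.of_le hk1)).differentiableAt one_ne_zero |>.hasFDerivAt
      have h2 := h1.inner ℝ h1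
      have h3 : (fun z => inner ℝ ((unitNormal γ ∘ φ) z) ((unitNormal γ ∘ φ) z)) =
          fun _ => (1 : ℝ) := by
        ext z
        rw [real_inner_self_eq_norm_sq, Function.comp_apply, hγ.norm_unitNormal, one_pow]
      rw [h3] at h2
      have h4 := DFunLike.congr_fun (h2.unique (hasFDerivAt_const 1 _)) x
      simp [hφ.axis] at h4
      rw [real_inner_comm] at h4
      have h5 := real_inner_comm (unitNormal γ (c s)) (fderiv ℝ (unitNormal γ ∘ φ) (s, 0) x)
      linarith
    refine ContinuousLinearMap.ext fun x => ?_
    rw [← sub_eq_zero]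
    have hxy : ∀ y, inner ℝ (fderiv ℝ (unitNormal β ∘ φ) (s, 0) x -
        fderiv ℝ (unitNormal α ∘ φ) (s, 0) x) (fderiv ℝ (α ∘ φ) (s, 0) y) = 0 := by
      intro y
      have h1 := hβ.inner_fderiv_unitNormal hM hk2 (hkn.trans hn) (hφk.of_le hk2) x y
      have h2 := hα.inner_fderiv_unitNormal hM (hk2.trans hkn) hn (hφk.of_le hk2) x y
      rw [d1, d2, hφ.axis, hN] at h1
      rw [hφ.axis] at h2
      rw [inner_sub_left, h1, h2, sub_self]
    have hxy' : ∀ w, inner ℝ (fderiv ℝ (unitNormal β ∘ φ) (s, 0) x -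
        fderiv ℝ (unitNormal α ∘ φ) (s, 0) x) (diffAt α (c s) w) = 0 := by
      intro w
      rw [← hφ.axis s]
      obtain ⟨y, rfl⟩ := hsurj w
      rw [hα.diffAt_paramDeriv (hk1.trans hkn) (hφk.of_le hk1)]
      exact hxy y
    refine eq_zero_of_inner_frame (N := unitNormal α (c s)) ⟨_, rfl⟩ (hα.norm_unitNormal (c s)) ?_ (hxy' e1) (hxy' e2)
    have h1 := key β k hβ hk2 (hkn.trans hn) x
    have h2 := key α n hα (hk2.trans hkn) hn x
    rw [hN] at h1
    rw [inner_sub_left, h1, h2, sub_self]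
  refine ⟨hd, hN, hdN, ?_⟩
  rw [← hφ.axis s]
  ext x : 1
  obtain ⟨x, rfl⟩ := hsurj x
  rw [hα.diffAt_unitNormal_paramDeriv hM (hk2.trans hkn) hn (hφk.of_le hk1),
    hβ.diffAt_unitNormal_paramDeriv hM hk2 (hkn.trans hn) (hφk.of_le hk1), hdN]

/-- The cycle of `α` is a maximal cycle of the deformation. -/
lemma IsMaximalCycle.isMaximalCycle_deformation (hM : IsOrientedAtlas M)
    (hα : IsImmersionOfClass n α)
    (hk : k + 2 ≤ n) (hk3 : 3 ≤ k) (hn : n ≤ ∞) (hc : IsMaximalCycle α c L)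
    (hφ : IsTubularChart k α c L η φ) (hδ : ∀ᶠ v in 𝓝 (0 : ℝ), δ v = 1) {ε : ℝ}
    (hβ : IsImmersionOfClass k (deformation α c η φ δ ε)) :
    IsMaximalCycle (deformation α c η φ δ ε) c L := by
  have hax := fun s => hc.normal_deformation_axis hM hα hk hk3 hn hφ hδ hβ s
  refine ⟨hc.contMDiff, fun s => ?_, fun s => ?_, hc.length_pos, hc.periodic, hc.injOn⟩
  · rw [(hax s).1]
    exact hc.unit_speed s
  · obtain ⟨h1, h2, -, h4⟩ := hax s
    have h := hc.direction s
    -- Unfolded, the condition involves only the differential, the normal and its differential at `c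
    -- s`, all unchanged.
    simp only [IsMaximalDirection, gaussCurvature, normalCurvature, geodesicTorsion, secondForm,
      firstForm] at h ⊢
    rw [h1, h2, h4]
    exact h

end Axis

/-! ### Effect of the deformation on the transverse derivative of the slope. -/

section Deformation

variable {M : Type*} [TopologicalSpace M] [ChartedSpace E2 M]
variable {α : M → E3} {c : ℝ → M} {L η : ℝ} {φ : ℝ × ℝ → M} {n k : WithTop ℕ∞} {δ : ℝ → ℝ}

lemma deformation_zero : deformation α c η φ δ 0 = α := by
  ext p : 1
  rw [deformation, zero_smul, add_zero]

variable [IsManifold 𝓘(ℝ, E2) ∞ M]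

lemma IsMaximalCycle.frame_deformation_axis (hM : IsOrientedAtlas M)
    (hα : IsImmersionOfClass n α)
    (hk : k + 2 ≤ n) (hk3 : 3 ≤ k) (hn : n ≤ ∞) (hc : IsMaximalCycle α c L)
    (hφ : IsTubularChart k α c L η φ) (hδ : ∀ᶠ v in 𝓝 (0 : ℝ), δ v = 1) {ε : ℝ}
    (hβ : IsImmersionOfClass k (deformation α c η φ δ ε)) (s : ℝ) :
    ‖diffAt (deformation α c η φ δ ε) (φ (s, 0)) (paramDeriv φ (s, 0) (1, 0))‖ = 1 ∧
    IsMaximalDirection (deformation α c η φ δ ε) (φ (s, 0)) (paramDeriv φ (s, 0) (1, 0)) ∧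
    diffAt (deformation α c η φ δ ε) (φ (s, 0)) (paramDeriv φ (s, 0) (0, 1)) =
      cross (unitNormal (deformation α c η φ δ ε) (φ (s, 0)))
        (diffAt (deformation α c η φ δ ε) (φ (s, 0)) (paramDeriv φ (s, 0) (1, 0))) := by
  have h13 : (1 : WithTop ℕ∞) ≤ 3 := by exact_mod_cast (show 1 ≤ 3 by norm_num)
  have hk1 : 1 ≤ k := h13.trans hk3
  have hkn : k ≤ n := (self_le_add_right k 2).trans hk
  have hcβ := hc.isMaximalCycle_deformation hM hα hk hk3 hn hφ hδ hβ
  obtain ⟨h1, h2, -⟩ := hc.normal_deformation_axis hM hα hk hk3 hn hφ hδ hβ s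
  rw [hφ.axis s, ← hφ.velocity_axis hk1 s]
  refine ⟨hcβ.unit_speed s, hcβ.direction s, ?_⟩
  rw [h1, h2]
  exact hφ.diffAt_snd hα (hk1.trans hkn) hk1 s

/-- The deformation changes the transverse derivative of the slope along the cycle by `ε / 4`. -/
lemma IsMaximalCycle.hasDerivAt_slope_deformation (hM : IsOrientedAtlas M)
    (hα : IsImmersionOfClass n α)
    (hk : k + 2 ≤ n) (hk3 : 3 ≤ k) (hn : n ≤ ∞) (hc : IsMaximalCycle α c L)
    (hφ : IsTubularChart k α c L η φ) (hδ : ∀ᶠ v in 𝓝 (0 : ℝ), δ v = 1) (s : ℝ) :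
    ∃ σ : ℝ, ∀ ε, IsImmersionOfClass k (deformation α c η φ δ ε) →
      HasDerivAt (fun v => slope (deformation α c η φ δ ε) φ (s, v)) (σ + ε / 4) 0 := by
  have h23 : (2 : WithTop ℕ∞) ≤ 3 := by exact_mod_cast (show 2 ≤ 3 by norm_num)
  have hkn : k ≤ n := (self_le_add_right k 2).trans hk
  have hk2 : 2 ≤ k := h23.trans hk3
  have hk1 : 1 ≤ k := one_le_two.trans hk2
  have hz : ((s, 0) : ℝ × ℝ).2 ∈ Ioo (-η) η := hφ.zero_mem
  have hφk := hφ.contMDiffAt hz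
  have hline : HasDerivAt (fun v : ℝ => (s, v)) ((0 : ℝ), (1 : ℝ)) 0 :=
    (hasDerivAt_const 0 s).prodMk (hasDerivAt_id 0)
  set I' : ℝ × ℝ → ℝ × ℝ → ℝ := fun x y =>
    inner ℝ (fderiv ℝ (α ∘ φ) (s, 0) x) (fderiv ℝ (fderiv ℝ (α ∘ φ)) (s, 0) (0, 1) y) +
      inner ℝ (fderiv ℝ (fderiv ℝ (α ∘ φ)) (s, 0) (0, 1) x) (fderiv ℝ (α ∘ φ) (s, 0) y) with hI'
  set II' : ℝ × ℝ → ℝ × ℝ → ℝ := fun x y =>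
    inner ℝ (unitNormal α (c s))
      (fderiv ℝ (fderiv ℝ (fderiv ℝ (α ∘ φ))) (s, 0) (0, 1) x y) +
      inner ℝ (fderiv ℝ (unitNormal α ∘ φ) (s, 0) (0, 1))
        (fderiv ℝ (fderiv ℝ (α ∘ φ)) (s, 0) x y) with hII'
  set τ := geodesicTorsion α (c s) (velocity c s) with hτdef
  have hτ0 : 0 < τ := (hc.direction s).2.2.2
  -- These derivatives use only the 2-jet, so they do not depend on `ε`.
  have hI : ∀ ε, IsImmersionOfClass k (deformation α c η φ δ ε) → ∀ x y,
      HasDerivAt (fun v => firstCoeff (deformation α c η φ δ ε) φ x y (s, v)) (I' x y) 0 := by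
    intro ε hβ x y
    obtain ⟨d1, d2, -⟩ := hc.fderiv_deformation_axis hM hα hk hk3 hn hφ hδ ε s
    have hb := ((hβ.contDiffAt_comp hk2 (hφk.of_le hk2)).fderiv_right (m := 1)
      (by norm_num)).differentiableAt one_ne_zero |>.hasFDerivAt
    have h1 := hb.comp_hasDerivAt (0 : ℝ) hline
    rw [d2] at h1
    have hx := h1.clm_apply (hasDerivAt_const (0 : ℝ) x)
    have hy := h1.clm_apply (hasDerivAt_const (0 : ℝ) y)
    refine (hx.inner ℝ hy).congr_deriv ?_
    simp [hI', d1]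
  -- The factor `x.2 * y.2` leaves the derivatives of `e` and `f` unchanged, and adds `ε τ` to that
  -- of `g`.
  have hII : ∀ ε, IsImmersionOfClass k (deformation α c η φ δ ε) → ∀ x y,
      HasDerivAt (fun v => secondCoeff (deformation α c η φ δ ε) φ x y (s, v))
        (II' x y + ε * (τ * (x.2 * y.2))) 0 := by
    intro ε hβ x y
    obtain ⟨d1, d2, d3⟩ := hc.fderiv_deformation_axis hM hα hk hk3 hn hφ hδ ε s
    obtain ⟨-, n1, n2, -⟩ := hc.normal_deformation_axis hM hα hk hk3 hn hφ hδ hβ s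
    have hN := (hβ.contDiffAt_unitNormal_comp hM (k := 1) (by rwa [one_add_one_eq_two])
      (hkn.trans hn) (hφk.of_le hk1)).differentiableAt one_ne_zero |>.hasFDerivAt
    have h1 := hN.comp_hasDerivAt (0 : ℝ) hline
    rw [n2] at h1
    refine (h1.inner ℝ (d3 x y)).congr_deriv ?_
    simp only [Function.comp_apply, hφ.axis, n1, d2, hII', inner_add_right, inner_smul_right,
      real_inner_self_eq_norm_sq, hα.norm_unitNormal]
    ring
  have hβ0 : IsImmersionOfClass k (deformation α c η φ δ 0) := by
    rw [deformation_zero]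
    exact ⟨hα.contMDiff.of_le hkn, hα.injective⟩
  have hval : ∀ ε, IsImmersionOfClass k (deformation α c η φ δ ε) → ∀ x y,
      secondCoeff (deformation α c η φ δ ε) φ x y (s, 0) = secondCoeff α φ x y (s, 0) := by
    intro ε hβ x y
    obtain ⟨d1, d2, -⟩ := hc.fderiv_deformation_axis hM hα hk hk3 hn hφ hδ ε s
    obtain ⟨-, n1, -⟩ := hc.normal_deformation_axis hM hα hk hk3 hn hφ hδ hβ s
    rw [secondCoeff, secondCoeff, d2, hφ.axis, n1]
  have hτ : secondCoeff α φ (1, 0) (0, 1) (s, 0) = τ := by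
    obtain ⟨g1, g2, g3⟩ := hc.frame_deformation_axis hM hα hk hk3 hn hφ hδ hβ0 s
    rw [deformation_zero] at g1 g2 g3
    rw [(hα.coeffs_axis hM (hk2.trans hkn) hn (hφk.of_le hk2) g1 g2 g3).2.2.2.1, hφ.axis,
      ← hφ.velocity_axis hk1 s]
  set e := secondCoeff α φ (1, 0) (1, 0) (s, 0)
  set g := secondCoeff α φ (0, 1) (0, 1) (s, 0)
  -- The witness is the formula of `hasDerivAt_slopeRoot` at `ε = 0`. The extra `ε τ` in `g'`
  -- contributes `e ε τ / (2e) / (2τ) = ε / 4`.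
  refine ⟨-(II' (1, 0) (1, 0) - (II' (1, 0) (1, 0) * g + e * II' (0, 1) (0, 1) -
    2 * τ * II' (1, 0) (0, 1) - (e * g - τ ^ 2) * (I' (1, 0) (1, 0) + I' (0, 1) (0, 1))) /
        (2 * e) - e * I' (1, 0) (1, 0)) / (2 * τ), fun ε hβ => ?_⟩
  obtain ⟨g1, g2, g3⟩ := hc.frame_deformation_axis hM hα hk hk3 hn hφ hδ hβ s
  obtain ⟨h1, h2, h3, -, h5, h6, h7, -⟩ :=
    hβ.coeffs_axis hM hk2 (hkn.trans hn) (hφk.of_le hk2) g1 g2 g3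
  have hmain := hasDerivAt_slopeRoot (hII ε hβ (1, 0) (1, 0)) (hII ε hβ (1, 0) (0, 1))
    (hII ε hβ (0, 1) (0, 1)) (hI ε hβ (1, 0) (1, 0)) (hI ε hβ (1, 0) (0, 1))
    (hI ε hβ (0, 1) (0, 1)) h1 h2 h3 h6 h7 h5
  refine hmain.congr_deriv ?_
  rw [hval ε hβ, hval ε hβ, hval ε hβ] at h6 h7
  rw [hval ε hβ, hval ε hβ, hval ε hβ, hτ]
  rw [hτ] at h6 h7
  have he : e ≠ 0 := by
    rw [show e = √(e * g - τ ^ 2) from h7]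
    exact (Real.sqrt_pos.2 h6).ne'
  change -(_ - (_ * g + e * _ - _ - (e * g - _) * _) / (2 * e) - e * _) / _ = _
  field_simp
  ring

end Deformation

end GMC

/-! ### The derivative of the return map as a function of `ε`. -/

theorem proposition4 {M : Type*} [TopologicalSpace M] [T2Space M] [ChartedSpace E2 M]
    [IsManifold 𝓘(ℝ, E2) ∞ M] (hM : GMC.IsOrientedAtlas M)
    (r : ℕ) (hr : 6 ≤ r) (α : M → E3) (hα : GMC.IsImmersionOfClass (r : WithTop ℕ∞) α)
    (c : ℝ → M) (L : ℝ) (hc : GMC.IsMaximalCycle α c L)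
    (η : ℝ) (φ : ℝ × ℝ → M)
    (hφ : GMC.IsTubularChart ((r - 2 : ℕ) : WithTop ℕ∞) α c L η φ)
    (δ : ℝ → ℝ) (hδ : ContDiff ℝ ∞ δ) (hδ_one : ∀ᶠ v in 𝓝 (0 : ℝ), δ v = 1)
    (hδ_supp : tsupport δ ⊆ Ioo (-η) η) :
    ∃ ε₀ : ℝ, 0 < ε₀ ∧ ∃ π : ℝ → ℝ → ℝ,
      (∀ ε : ℝ, |ε| < ε₀ →
        GMC.IsImmersionOfClass ((r - 2 : ℕ) : WithTop ℕ∞) (GMC.deformation α c η φ δ ε) ∧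
        GMC.IsMaximalCycle (GMC.deformation α c η φ δ ε) c L ∧
        GMC.IsReturnMap (GMC.deformation α c η φ δ ε) L η φ (π ε) ∧
        DifferentiableAt ℝ (π ε) 0 ∧ 0 < deriv (π ε) 0 ∧
        (ε ≠ 0 → GMC.IsHyperbolicMaximalCycle (GMC.deformation α c η φ δ ε) c L η φ)) ∧
      HasDerivAt (fun ε => Real.log (deriv (π ε) 0)) (L / 4) 0 := by
  have hn : (r : WithTop ℕ∞) ≤ ∞ := mod_cast (le_top : (r : ℕ∞) ≤ ⊤)
  have hk : ((r - 2 : ℕ) : WithTop ℕ∞) + 2 ≤ r := by exact_mod_cast (show r - 2 + 2 ≤ r by omega)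
  have hk3 : 3 ≤ ((r - 2 : ℕ) : WithTop ℕ∞) := by exact_mod_cast (show 3 ≤ r - 2 by omega)
  have hk1 : 1 ≤ ((r - 2 : ℕ) : WithTop ℕ∞) := by exact_mod_cast (show 1 ≤ r - 2 by omega)
  have hkn : ((r - 2 : ℕ) : WithTop ℕ∞) ≤ ∞ := 
    ((self_le_add_right _ 2).trans hk).trans hn
  set k : WithTop ℕ∞ := ((r - 2 : ℕ) : WithTop ℕ∞)
  have hL := hc.length_pos
  obtain ⟨ε₁, hε₁, himm⟩ := Metric.eventually_nhds_iff.1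
    (hc.eventually_isImmersionOfClass hM hα hk hk1 hn hφ hδ hδ_supp)
  replace himm : ∀ ε : ℝ, |ε| < ε₁ → GMC.IsImmersionOfClass k (GMC.deformation α c η φ δ ε) :=
    fun ε hε => himm (by rwa [Real.dist_eq, sub_zero])
  -- `σ` is chosen before `ε`: the same function serves for all deformations, and so makes the
  -- integral affine in `ε`.
  choose σ hσ using fun s => hc.hasDerivAt_slope_deformation hM hα hk hk3 hn hφ hδ_one s
  have hz : ∀ s : ℝ, ((s, 0) : ℝ × ℝ).2 ∈ Ioo (-η) η := fun _ => hφ.zero_mem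
  have hstrip : ∀ s : ℝ, ∀ᶠ z in 𝓝 ((s, 0) : ℝ × ℝ), z.2 ∈ Ioo (-η) η := fun s =>
    (continuous_snd.tendsto (s, (0 : ℝ))).eventually (isOpen_Ioo.mem_nhds (hz s))
  have hdir : ∀ ε : ℝ, |ε| < ε₁ → ∀ s : ℝ,
      ContDiffAt ℝ 1 (GMC.slope (GMC.deformation α c η φ δ ε) φ) (s, 0) ∧
      ∀ᶠ z in 𝓝 ((s, 0) : ℝ × ℝ), GMC.IsMaximalDirection (GMC.deformation α c η φ δ ε) (φ z)
        (GMC.paramDeriv φ z (1, GMC.slope (GMC.deformation α c η φ δ ε) φ z)) := by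
    intro ε hε s
    obtain ⟨g1, g2, g3⟩ := hc.frame_deformation_axis hM hα hk hk3 hn hφ hδ_one (himm ε hε) s
    exact (himm ε hε).eventually_isMaximalDirection_slope hM hk3 hkn
      ((hφ.contMDiffAt (hz s)).of_le hk3)
      ((hstrip s).mono fun z hz' => hφ.injective_paramDeriv hz') g1 g2 g3
  have haxis : ∀ ε : ℝ, |ε| < ε₁ → ∀ s : ℝ,
      GMC.slope (GMC.deformation α c η φ δ ε) φ (s, 0) = 0 := by
    intro ε hε s
    obtain ⟨g1, g2, g3⟩ := hc.frame_deformation_axis hM hα hk hk3 hn hφ hδ_one (himm ε hε) s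
    have hk2 : (2 : WithTop ℕ∞) ≤ k :=
      (by exact_mod_cast (show 2 ≤ 3 by norm_num) : (2 : WithTop ℕ∞) ≤ 3).trans hk3
    exact ((himm ε hε).coeffs_axis hM hk2 hkn ((hφ.contMDiffAt (hz s)).of_le hk2)
      g1 g2 g3).2.2.2.2.2.2.2.1
  have hfd : ∀ ε : ℝ, |ε| < ε₁ → ∀ s : ℝ,
      fderiv ℝ (GMC.slope (GMC.deformation α c η φ δ ε) φ) (s, 0) (0, 1) = σ s + ε / 4 := by
    intro ε hε s
    have h1 := ((hdir ε hε s).1.differentiableAt one_ne_zero).hasFDerivAt.comp_hasDerivAt (0 : ℝ)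
      ((hasDerivAt_const 0 s).prodMk (hasDerivAt_id 0))
    exact h1.unique (hσ s ε (himm ε hε))
  -- `σ` was chosen pointwise; at `ε = 0` it is the transverse derivative of a `C^1` slope on the
  -- axis.
  have hσc : Continuous σ := by
    rw [continuous_iff_continuousAt]
    intro s
    have h0 : |(0 : ℝ)| < ε₁ := by rwa [abs_zero]
    have h1 : ContinuousAt (fun z => fderiv ℝ (GMC.slope (GMC.deformation α c η φ δ 0) φ) z (0, 1))
        (s, 0) := ((hdir 0 h0 s).1.fderiv_right (m := 0) (by simp)).continuousAt.clm_apply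
      continuousAt_const
    have h2 : ContinuousAt (fun s : ℝ => (s, (0 : ℝ))) s := by fun_prop
    refine (ContinuousAt.comp (f := fun s : ℝ => (s, (0 : ℝ))) h1 h2).congr
      (Eventually.of_forall fun t => ?_)
    have := hfd 0 h0 t
    rw [zero_div, add_zero] at this
    exact this
  set C := ∫ s in (0 : ℝ)..L, σ s
  have hint : ∀ ε : ℝ, |ε| < ε₁ →
      ∫ s in (0 : ℝ)..L, fderiv ℝ (GMC.slope (GMC.deformation α c η φ δ ε) φ) (s, 0) (0, 1) =
        C + ε * (L / 4) := by
    intro ε hε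
    simp only [hfd ε hε]
    rw [intervalIntegral.integral_add (hσc.intervalIntegrable _ _) intervalIntegrable_const,
      intervalIntegral.integral_const]
    simp only [C, smul_eq_mul]
    ring
  have hret : ∀ ε : ℝ, |ε| < ε₁ → ∃ π : ℝ → ℝ,
      GMC.IsReturnMap (GMC.deformation α c η φ δ ε) L η φ π ∧
        HasDerivAt π (Real.exp (C + ε * (L / 4))) 0 := by
    intro ε hε
    obtain ⟨π, hπ0, hπ, hπd⟩ := GMC.exists_return_map hL
      (fun s _ => (hdir ε hε s).1) (fun s _ => haxis ε hε s)
      (fun s _ => (hstrip s).and (hdir ε hε s).2)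
    rw [hint ε hε] at hπd
    refine ⟨π, ⟨hπ0, hπ.mono fun v₀ hv => ?_⟩, hπd⟩
    obtain ⟨v, hv1, hv2, hv3, hv4⟩ := hv
    refine ⟨v, hv1, hv2, hv3, fun s hs => ?_⟩
    obtain ⟨⟨h1, h2⟩, h3⟩ := hv4 s hs
    refine ⟨h1, ?_⟩
    rw [GMC.velocity_param h3 ((hφ.contMDiffAt (z := (s, v s)) h1).of_le hk1)]
    exact h2
  choose! π hπ hπd using hret
  -- If `C = 0`, every `ε ≠ 0` makes the exponent nonzero; otherwise its only zero has `|ε| = |C| /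
  -- (L / 4)`, and `ε₀` stays within that radius.
  obtain ⟨ε₀, hε₀, hε₀₁, hne⟩ : ∃ ε₀ : ℝ, 0 < ε₀ ∧ ε₀ ≤ ε₁ ∧
      ∀ ε : ℝ, |ε| < ε₀ → ε ≠ 0 → C + ε * (L / 4) ≠ 0 := by
    by_cases hC : C = 0
    · refine ⟨ε₁, hε₁, le_rfl, fun ε _ hε0 => ?_⟩
      rw [hC, zero_add]
      positivity
    · have hC' : 0 < |C| := abs_pos.2 hC
      refine ⟨min ε₁ (|C| / (L / 4)), by positivity, min_le_left _ _, fun ε hε _ h0 => ?_⟩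
      have h1 := (lt_div_iff₀ (by positivity)).1 (hε.trans_le (min_le_right _ _))
      rw [show C = -(ε * (L / 4)) by linarith, abs_neg, abs_mul,
        abs_of_pos (show 0 < L / 4 by positivity)] at h1
      exact lt_irrefl _ h1
  refine ⟨ε₀, hε₀, π, fun ε hε => ?_, ?_⟩
  · have hε1 := hε.trans_le hε₀₁
    have hcyc := hc.isMaximalCycle_deformation hM hα hk hk3 hn hφ hδ_one (himm ε hε1)
    have hd := hπd ε hε1
    refine ⟨himm ε hε1, hcyc, hπ ε hε1, hd.differentiableAt, ?_, fun hε0 => ⟨hcyc, π ε, hπ ε hε1,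
      hd.differentiableAt, ?_⟩⟩
    · rw [hd.deriv]
      exact Real.exp_pos _
    · rw [hd.deriv, Ne, Real.exp_eq_one_iff]
      exact hne ε hε hε0
  · have h1 : HasDerivAt (fun ε : ℝ => C + ε * (L / 4)) (L / 4) 0 := by
      simpa using ((hasDerivAt_id (0 : ℝ)).mul_const (L / 4)).const_add C
    refine h1.congr_of_eventuallyEq ?_
    filter_upwards [Metric.ball_mem_nhds (0 : ℝ) hε₁] with ε hε
    rw [Metric.mem_ball, Real.dist_eq, sub_zero] at hε
    rw [(hπd ε hε).deriv, Real.log_exp]
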